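/- Let $G$ be a real reductive group, i.e. a Lie group which is a finite covering of an open subgroup of the group of real points of a reductive linear algebraic group defined over $\mathbb R$. Let $K$ be a maximal compact subgroup of $G$, let $\theta$ be a Cartan involution of $G$ with fixed point set $K$, and let $\mathfrak g_0=\mathfrak k_0\oplus\mathfrak p_0$ be the decomposition of the Lie algebra of $G$ into the $+1$- and $-1$-eigenspaces of the differential of $\theta$. Let $B$ be an $\mathrm{Ad}(G)$-invariant symmetric bilinear form on $\mathfrak g_0$ that is negative definite on $\mathfrak k_0$ and positive definite on $\mathfrak p_0=\mathfrak k_0^{\perp}$. Let $\mathfrak p=\mathfrak p_0\otimes_{\mathbb R}\mathbb C$ with the non-degenerate complex quadratic form $q$ induced by $B$, let $SO(\mathfrak p)$ be its complex special orthogonal group, and let $Spin(\mathfrak p)$ be the complex spin group, i.e. the group of products of an even number of vectors $v\in\mathfrak p$ with $q(v)=1$ in the Clifford algebra of $q$ (in which $v^2=-q(v)$). The map $x\mapsto(v\mapsto xvx^{-1})$ is a double covering $Spin(\mathfrak p)\to SO(\mathfrak p)$. Assume that the adjoint action of $K$ on $\mathfrak p$ defines a homomorphism $\mathrm{Ad}:K\to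 SO(\mathfrak p)$ (that is, it has determinant one). If $\mathrm{Ad}:K\to SO(\mathfrak p)$ does not factor over $Spin(\mathfrak p)\to SO(\mathfrak p)$ (as a composition with a continuous homomorphism $K\to Spin(\mathfrak p)$), then there is a double covering $\beta:\tilde G\to G$ of Lie groups (a surjective smooth covering homomorphism whose kernel has two elements) such that, with $\tilde K=\beta^{-1}(K)$, the induced homomorphism $\mathrm{Ad}\circ\beta|_{\tilde K}:\tilde K\to SO(\mathfrak p)$ factors over $Spin(\mathfrak p)\to SO(\mathfrak p)$, by a continuous homomorphism $\tilde K\to Spin(\mathfrak p)$. Moreover, the kernel of $\beta$ lies in the center of $\tilde G$. -/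

import Mathlib

open scoped Manifold ContDiff TensorProduct Matrix

universe u

noncomputable section

namespace DoubleCover

/-! ### The adjoint representation of a Lie group -/

section LieGroups

variable (d : ℕ) {G : Type u} [TopologicalSpace G] [Group G]
  [ChartedSpace (EuclideanSpace ℝ (Fin d)) G]

/-- The differential at the identity of a map `f : G → G` that fixes the identity, as an
endomorphism of the Lie algebra `𝔤₀ = T₁ G`. -/
def diffOne (f : G → G) : Module.End ℝ (GroupLieAlgebra (𝓡 d) G) where
  toFun v := (mfderiv (𝓡 d) (𝓡 d) f 1 : EuclideanSpace ℝ (Fin d) →L[ℝ] EuclideanSpace ℝ (Fin d)) v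
  map_add' v w := ContinuousLinearMap.map_add (mfderiv (𝓡 d) (𝓡 d) f 1) v w
  map_smul' c v := ContinuousLinearMap.map_smul (mfderiv (𝓡 d) (𝓡 d) f 1) c v

theorem diffOne_id : diffOne d (fun x : G => x) = 1 := by
  ext v : 1
  change (mfderiv (𝓡 d) (𝓡 d) (id : G → G) 1) v = v
  rw [mfderiv_id]
  rfl

theorem diffOne_comp {f g : G → G} (hf : ContMDiff (𝓡 d) (𝓡 d) ∞ f)
    (hg : ContMDiff (𝓡 d) (𝓡 d) ∞ g) (hf1 : f 1 = 1) :
    diffOne d (fun x => g (f x)) = diffOne d g * diffOne d f := by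
  ext v : 1
  have hg' : MDifferentiableAt (𝓡 d) (𝓡 d) g 1 := (hg 1).mdifferentiableAt (by simp)
  have hf' : MDifferentiableAt (𝓡 d) (𝓡 d) f 1 := (hf 1).mdifferentiableAt (by simp)
  change (mfderiv (𝓡 d) (𝓡 d) (g ∘ f) 1) v = _
  rw [mfderiv_comp_of_eq hg' hf' hf1]
  change (mfderiv (𝓡 d) (𝓡 d) g (f 1)) (mfderiv (𝓡 d) (𝓡 d) f 1 v)
    = (mfderiv (𝓡 d) (𝓡 d) g 1) (mfderiv (𝓡 d) (𝓡 d) f 1 v)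
  rw [hf1]

variable [LieGroup (𝓡 d) ∞ G]

theorem contMDiff_conj (g : G) : ContMDiff (𝓡 d) (𝓡 d) ∞ (fun x : G => g * x * g⁻¹) :=
  (contMDiff_const.mul contMDiff_id).mul contMDiff_const

/-- The adjoint representation `Ad : G → GL(𝔤₀)`: `Ad(g)` is the differential at the identity of
`x ↦ g x g⁻¹`. -/
def Ad : Representation ℝ G (GroupLieAlgebra (𝓡 d) G) where
  toFun g := diffOne d (fun x => g * x * g⁻¹)
  map_one' := by simpa using diffOne_id d (G := G)
  map_mul' g h := by
    rw [← diffOne_comp d (contMDiff_conj d h) (contMDiff_conj d g) (by simp)]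
    congr 1
    funext x
    group

/-! ### Real reductive groups, Cartan involutions and the Cartan decomposition -/

/-- A subgroup of `GL(n, ℝ)` is real algebraic if it is cut out by a set of real polynomials
in the matrix entries. -/
def IsRealAlgebraic {n : ℕ} (H : Subgroup (GL (Fin n) ℝ)) : Prop :=
  ∃ S : Set (MvPolynomial (Fin n × Fin n) ℝ),
    ∀ g : GL (Fin n) ℝ, g ∈ H ↔ ∀ f ∈ S, MvPolynomial.eval (fun ij => g.1 ij.1 ij.2) f = 0

/-- A realization of the Lie group `G` as a real reductive group: a Lie group homomorphism
`π : G → GL(n, ℝ)` which is a finite covering of an open subgroup of a reductive real algebraic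
group. A real algebraic group is reductive iff in suitable coordinates of `ℝⁿ` it is stable under
transposition; the coordinates are chosen so. -/
structure IsRealization {n : ℕ} (π : G →* GL (Fin n) ℝ) : Prop where
  /-- `π` is smooth. -/
  smooth : ∀ i j, ContMDiff (𝓡 d) 𝓘(ℝ, ℝ) ∞ (fun g => (π g).1 i j)
  /-- `π` is an immersion at the identity (hence everywhere). -/
  immersion : ∀ v : GroupLieAlgebra (𝓡 d) G,
    (∀ i j, mfderiv (𝓡 d) 𝓘(ℝ, ℝ) (fun g => (π g).1 i j) 1 v = 0) → v = 0
  /-- `π` is a covering of its image. -/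
  covering : IsCoveringMap π.rangeRestrict
  /-- The covering is finite. -/
  finite_ker : Finite π.ker
  /-- The image is an open subgroup of a real algebraic group stable under transposition. -/
  open_range : ∃ H : Subgroup (GL (Fin n) ℝ), IsRealAlgebraic H ∧
    (∀ g ∈ H, ∃ h ∈ H, h.1 = g.1ᵀ) ∧ π.range ≤ H ∧ IsOpen {h : H | h.1 ∈ π.range}

/-- `K` is a maximal compact subgroup of the real reductive group `G`, and `θ` is a Cartan
involution of `G` with fixed point set `K`: an involutive automorphism of the Lie group `G` which in
some realization `π` of `G` lies over `g ↦ (gᵗ)⁻¹`. In particular `G` is a real reductive group. -/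
structure IsCartanInvolution (K : Subgroup G) (θ : G ≃* G) : Prop where
  maximal_compact : Maximal (fun L : Subgroup G => IsCompact (L : Set G)) K
  smooth : ContMDiff (𝓡 d) (𝓡 d) ∞ θ
  involutive : Function.Involutive θ
  fixed : ∀ g, θ g = g ↔ g ∈ K
  realization : ∃ (n : ℕ) (π : G →* GL (Fin n) ℝ), IsRealization d π ∧
    ∀ g, (π (θ g)).1 = ((π g)⁻¹).1ᵀ

/-- `𝔨₀`, the Lie algebra of the fixed point group `K` of `θ`: the `+1`-eigenspace of the
differential of `θ`. -/
def k₀ (θ : G ≃* G) : Submodule ℝ (GroupLieAlgebra (𝓡 d) G) :=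
  Module.End.eigenspace (diffOne d θ) 1

/-- `𝔭₀`, the `-1`-eigenspace of the differential of `θ`. -/
def p₀ (θ : G ≃* G) : Submodule ℝ (GroupLieAlgebra (𝓡 d) G) :=
  Module.End.eigenspace (diffOne d θ) (-1)

/-- The symmetric bilinear forms `B` on `𝔤₀` that are `Ad(G)`-invariant, negative definite on `𝔨₀`
and positive definite on `𝔭₀`, where `𝔭₀` is the orthocomplement of `𝔨₀`. -/
structure IsInvariantForm (θ : G ≃* G)
    (B : LinearMap.BilinForm ℝ (GroupLieAlgebra (𝓡 d) G)) : Prop where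
  symm : ∀ X Y, B X Y = B Y X
  invariant : ∀ (g : G) (X Y), B (Ad d g X) (Ad d g Y) = B X Y
  neg_def : ∀ X ∈ k₀ d θ, X ≠ 0 → B X X < 0
  pos_def : ∀ X ∈ p₀ d θ, X ≠ 0 → 0 < B X X
  orthogonal : ∀ Y, Y ∈ p₀ d θ ↔ ∀ X ∈ k₀ d θ, B X Y = 0

variable {d} {K : Subgroup G} {θ : G ≃* G}

theorem Ad_mem_p₀ (h : IsCartanInvolution d K θ) (k : K) {X : GroupLieAlgebra (𝓡 d) G}
    (hX : X ∈ p₀ d θ) : Ad d k.1 X ∈ p₀ d θ := by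
  have hk : θ k.1 = k.1 := (h.fixed k.1).2 k.2
  have key : diffOne d θ * Ad d k.1 = Ad d k.1 * diffOne d θ := by
    change diffOne d θ * diffOne d _ = diffOne d _ * diffOne d θ
    rw [← diffOne_comp d (contMDiff_conj d k.1) h.smooth (by simp),
      ← diffOne_comp d h.smooth (contMDiff_conj d k.1) (by simp)]
    congr 1
    funext x
    simp [hk]
  have hX' : diffOne d θ X = (-1 : ℝ) • X := Module.End.mem_eigenspace_iff.1 hX
  refine Module.End.mem_eigenspace_iff.2 ?_
  have := LinearMap.congr_fun key X
  rw [Module.End.mul_apply, Module.End.mul_apply, hX', map_smul] at this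
  exact this

/-- The adjoint representation of `K` on `𝔭₀`. -/
def AdReal (h : IsCartanInvolution d K θ) : Representation ℝ K (p₀ d θ) where
  toFun k := (Ad d k.1).restrict fun _ hX => Ad_mem_p₀ h k hX
  map_one' := by ext X; simp
  map_mul' k l := by ext X; simp

variable (d θ) in
/-- `𝔭`, the complexification of `𝔭₀`. -/
abbrev P : Type := ℂ ⊗[ℝ] p₀ d θ

/-- The adjoint representation of `K` on `𝔭`. -/
def AdP (h : IsCartanInvolution d K θ) : Representation ℂ K (P d θ) where
  toFun k := (AdReal h k).baseChange ℂ
  map_one' := by rw [map_one]; exact LinearMap.baseChange_id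
  map_mul' k l := by rw [map_mul]; exact LinearMap.baseChange_comp _ _

variable (θ) in
/-- The non-degenerate complex quadratic form `q` on `𝔭` given by (the complexification of) `B`. -/
def q (B : LinearMap.BilinForm ℝ (GroupLieAlgebra (𝓡 d) G)) : QuadraticForm ℂ (P d θ) :=
  QuadraticForm.baseChange ℂ (B.restrict (p₀ d θ)).toQuadraticMap

variable (d) in
/-- `β : G' → G` is a double covering of Lie groups. -/
structure IsDoubleCovering {G' : Type u} [TopologicalSpace G'] [Group G']
    [ChartedSpace (EuclideanSpace ℝ (Fin d)) G'] (β : G' →* G) : Prop where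
  covering : IsCoveringMap β
  localDiffeo : IsLocalDiffeomorph (𝓡 d) (𝓡 d) ∞ β
  surjective : Function.Surjective β
  card_ker : Nat.card β.ker = 2

end LieGroups

/-! ### The complex spin group -/

section SpinGroups

variable {V : Type*} [AddCommGroup V] [Module ℂ V] (q : QuadraticForm ℂ V)

/-- The complex special orthogonal group `SO(q)`. -/
def SO : Submonoid (Module.End ℂ V) where
  carrier := {f | (∀ v, q (f v) = q v) ∧ LinearMap.det f = 1}
  one_mem' := by simp
  mul_mem' := by
    rintro f g ⟨hf, hf'⟩ ⟨hg, hg'⟩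
    exact ⟨fun v => by rw [Module.End.mul_apply, hf, hg], by rw [map_mul, hf', hg', one_mul]⟩

/-- The Clifford algebra of `q` with the sign convention `v ^ 2 = -q(v)`. -/
abbrev Cl : Type _ := CliffordAlgebra (-q)

/-- The canonical topology of the (finite-dimensional, if `V` is) complex vector space `Cl q`. -/
instance : TopologicalSpace (Cl q) := moduleTopology ℂ (Cl q)

/-- The complex spin group: the products of even length of vectors `v` and inverses of vectors,
with `q(v) ≠ 0`, of spinor norm one. Over `ℂ` these are exactly the products of an even number of
vectors `v` with `q(v) = 1`. -/
abbrev Spin : Submonoid (Cl q) := spinGroup (-q)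

theorem ι_injective : Function.Injective (CliffordAlgebra.ι (-q)) := by
  intro v w h
  have := congrArg (CliffordAlgebra.equivExterior (-q)) h
  simpa [CliffordAlgebra.changeForm_ι, CliffordAlgebra.equivExterior] using this

theorem exists_spin_act (x : Spin q) (v : V) :
    ∃ w, CliffordAlgebra.ι (-q) w = x.1 * CliffordAlgebra.ι (-q) v * (x⁻¹).1 := by
  have := spinGroup.conjAct_smul_ι_mem_range_ι (Q := -q) (x := spinGroup.toUnits x) x.2 v
  exact this

/-- The vector `x.v = x v x⁻¹`. -/
def spinActVec (x : Spin q) (v : V) : V := (exists_spin_act q x v).choose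

theorem ι_spinActVec (x : Spin q) (v : V) :
    CliffordAlgebra.ι (-q) (spinActVec q x v) = x.1 * CliffordAlgebra.ι (-q) v * (x⁻¹).1 :=
  (exists_spin_act q x v).choose_spec

/-- The action `x.v = x v x⁻¹` of `Spin(q)` on `V`. It takes values in `SO(q)` if `q` is
non-degenerate (and `V` is finite-dimensional). -/
def spinAct : Representation ℂ (Spin q) V where
  toFun x :=
    { toFun := spinActVec q x
      map_add' := fun v w => ι_injective q <| by
        simp only [map_add, ι_spinActVec, mul_add, add_mul]
      map_smul' := fun c v => ι_injective q <| by
        simp only [map_smul, ι_spinActVec, RingHom.id_apply, mul_smul_comm, smul_mul_assoc] }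
  map_one' := LinearMap.ext fun v => ι_injective q <| by
    change CliffordAlgebra.ι (-q) (spinActVec q 1 v) = CliffordAlgebra.ι (-q) v
    rw [ι_spinActVec]
    simp
  map_mul' x y := LinearMap.ext fun v => ι_injective q <| by
    change CliffordAlgebra.ι (-q) (spinActVec q (x * y) v) =
      CliffordAlgebra.ι (-q) (spinActVec q x (spinActVec q y v))
    simp only [ι_spinActVec, mul_inv_rev, Submonoid.coe_mul, mul_assoc]

/-- The homomorphism `ρ` from the topological group `L` to linear maps (in practice into `SO(q)`)
factors over `Spin(q) → SO(q)`: there is a continuous homomorphism `φ : L → Spin(q)` whose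
composition with `Spin(q) → SO(q)` is `ρ`. -/
def FactorsOverSpin {L : Type*} [Group L] [TopologicalSpace L] (ρ : Representation ℂ L V) : Prop :=
  ∃ φ : L →* Spin q, Continuous φ ∧ (spinAct q).comp φ = ρ

end SpinGroups

end DoubleCover

end

noncomputable section

namespace DoubleCover

/-! ### Clifford algebras of finite-dimensional complex quadratic spaces -/

section Clifford

open CliffordAlgebra

variable {R M ι : Type*} [Field R] [AddCommGroup M] [Module R M] [Fintype ι]

/-! Choose `B`-orthonormal coordinates `𝔭₀ ≅ ℝⁿ` and `𝔨₀ ≅ W` with the sign of `B` reversed on `𝔨₀`.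
In them `B` is `‖v‖² - ‖w‖²`, so every `Ad g` preserves the open cone `‖w‖ < ‖v‖` and lies in the
monoid `coneMonoid n W`. The upper left block of such an operator is injective (`injective_corner`),
and Gram-Schmidt attaches to it continuously an orthogonal operator `rot`. Pulling back the pin
covering of `O(n)` along `rot` gives a double covering `ConeCover` of the cone monoid; what has to
be found is a multiplication on it.

The map `rot` is not multiplicative in general, but it is on block diagonal operators with isometric
upper left block (`IsBlockIsometry`). The deformation `scale` connects each operator at time `1`
with such a block operator at time `0` and keeps `rot` constant (`rot_scale`). At time `0`, lifts
are multiplied in the Clifford algebra; homotopy lifting carries this product to time `1`.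
Associativity, the unit laws and the sign rules hold at time `0` and follow at time `1` by
uniqueness of path lifting (`eq_one_of_path`). Since `scale` ends at operators with zero lower right
block, the argument needs a monoid of operators rather than a group. No global Cartan decomposition
of `G` enters.

Pulling `ConeCover` back along `Ad` gives the group `PinExt`, a double covering of `G` with central
kernel `{1, -1}`, whose Lie group structure is pulled back from `G`. On `K` the operators `Ad k` are
block isometries, so the pin component is a homomorphism there (`pin_mul_of_block`); determinant one
makes it even, hence a map to the spin group (`factorsOverSpin_of_block`).

That the fibres of the pin covering are `{x, -x}` rests on the graded centre of the Clifford algebra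
being the scalars. Its local triviality comes from explicit local sections
(`exists_local_section_pinPairs`). -/

theorem finite_cliffordAlgebra [Invertible (2 : R)] [Module.Finite R M] (Q : QuadraticForm R M) :
    Module.Finite R (CliffordAlgebra Q) := by
  have : Module.Finite R (ExteriorAlgebra R M) :=
    Module.Finite.of_basis (Module.finBasis R M).ExteriorAlgebra
  exact Module.Finite.equiv (equivExterior Q).symm

/-- The Euler operator `∑ eᵢ ∧ (eⁱ ⌋ x)` of the exterior algebra is the degree. -/
theorem sum_ι_mul_contractLeft (E : Module.Basis ι R M) (k : ℕ) {x : ExteriorAlgebra R M}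
    (hx : x ∈ ⋀[R]^k M) :
    ∑ i, ExteriorAlgebra.ι R (E i) * contractLeft (Q := (0 : QuadraticForm R M)) (E.coord i) x
      = (k : R) • x := by
  induction hx using Submodule.pow_induction_on_left' with
  | algebraMap r => simp [contractLeft_algebraMap]
  | add x y i hx hy ihx ihy => simp [mul_add, Finset.sum_add_distrib, ihx, ihy, smul_add]
  | mem_mul m hm i x hx ih =>
    obtain ⟨v, rfl⟩ := hm
    have hv : ∑ j, E.coord j v • ExteriorAlgebra.ι R (E j) = ExteriorAlgebra.ι R v := by
      conv_rhs => rw [← E.sum_repr v, map_sum]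
      simp only [map_smul, Module.Basis.coord_apply]
    have hanti (j : ι) : ExteriorAlgebra.ι R (E j) * ExteriorAlgebra.ι R v
        = - (ExteriorAlgebra.ι R v * ExteriorAlgebra.ι R (E j)) :=
      eq_neg_of_add_eq_zero_left (ExteriorAlgebra.ι_add_mul_swap _ _)
    -- Contraction is an antiderivation and `E j` anticommutes with `v`, so the two signs cancel and
    -- the Euler operator acts as a derivation.
    have key (j : ι) : ExteriorAlgebra.ι R (E j) *
        contractLeft (Q := (0 : QuadraticForm R M)) (E.coord j) (ExteriorAlgebra.ι R v * x)
        = (E.coord j v • ExteriorAlgebra.ι R (E j)) * x + ExteriorAlgebra.ι R v *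
          (ExteriorAlgebra.ι R (E j) * contractLeft (Q := (0 : QuadraticForm R M)) (E.coord j) x) := by
      rw [show contractLeft (Q := (0 : QuadraticForm R M)) (E.coord j) (ExteriorAlgebra.ι R v * x)
        = E.coord j v • x - ExteriorAlgebra.ι R v * contractLeft (E.coord j) x from
          contractLeft_ι_mul (Q := 0) _ _ _, mul_sub, mul_smul_comm, smul_mul_assoc, ← mul_assoc, hanti,
          ← mul_assoc, neg_mul, sub_neg_eq_add]
    rw [Finset.sum_congr rfl fun j _ => key j, Finset.sum_add_distrib, ← Finset.sum_mul, hv,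
      ← Finset.mul_sum, ih]
    simp [add_smul, add_comm]

/-- The linear isomorphism with the exterior algebra commutes with contractions, so the question
moves there. If all contractions vanish, so does the Euler operator; as it multiplies degree `k` by
`k`, only the degree `0` component survives in characteristic zero. -/
theorem mem_range_algebraMap_of_contractLeft_eq_zero [CharZero R] [Invertible (2 : R)]
    (E : Module.Basis ι R M) {Q : QuadraticForm R M} {x : CliffordAlgebra Q}
    (h : ∀ i, contractLeft (E.coord i) x = 0) :
    ∃ c : R, x = algebraMap R _ c := by
  suffices ∃ c : R, equivExterior Q x = algebraMap R _ c by
    obtain ⟨c, hc⟩ := this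
    refine ⟨c, (equivExterior Q).injective ?_⟩
    rw [hc]
    exact (changeForm_algebraMap (changeForm.associated_neg_proof (Q := Q)) c).symm
  set y := equivExterior Q x with hy
  have hy0 (i : ι) : contractLeft (Q := (0 : QuadraticForm R M)) (E.coord i) y = 0 := by
    have := changeForm_contractLeft (changeForm.associated_neg_proof (Q := Q)) (E.coord i) x
    rw [h i, map_zero] at this
    exact this.symm
  let 𝒜 : ℕ → Submodule R (ExteriorAlgebra R M) := fun i => ⋀[R]^i M
  have hlin : ∀ z : ExteriorAlgebra R M, ∀ k,
      (DirectSum.decompose 𝒜 (∑ i, ExteriorAlgebra.ι R (E i) *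
        contractLeft (Q := (0 : QuadraticForm R M)) (E.coord i) z) k : ExteriorAlgebra R M)
      = (k : R) • (DirectSum.decompose 𝒜 z k : ExteriorAlgebra R M) := by
    intro z k
    induction z using DirectSum.Decomposition.inductionOn 𝒜 with
    | zero => simp
    | @homogeneous j m =>
      have hm := (𝒜 j).smul_mem (j : R) m.2
      rw [sum_ι_mul_contractLeft E j m.2]
      by_cases hjk : j = k
      · subst hjk
        rw [DirectSum.decompose_of_mem_same 𝒜 hm, DirectSum.decompose_of_mem_same 𝒜 m.2]
      · rw [DirectSum.decompose_of_mem_ne 𝒜 hm hjk, DirectSum.decompose_of_mem_ne 𝒜 m.2 hjk,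
          smul_zero]
    | add z w hz hw =>
      simp only [map_add, mul_add, Finset.sum_add_distrib, DirectSum.decompose_add,
        DirectSum.add_apply, Submodule.coe_add, smul_add, hz, hw]
  have hk (k : ℕ) (hk : k ≠ 0) : (DirectSum.decompose 𝒜 y k : ExteriorAlgebra R M) = 0 := by
    have := hlin y k
    simp only [hy0, mul_zero, Finset.sum_const_zero, DirectSum.decompose_zero,
      DirectSum.zero_apply, Submodule.coe_zero] at this
    exact (smul_eq_zero.1 this.symm).resolve_left (by exact_mod_cast hk)
  classical
  have hy1 : y = (DirectSum.decompose 𝒜 y 0 : ExteriorAlgebra R M) := by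
    conv_lhs => rw [← DirectSum.sum_support_decompose 𝒜 y]
    refine Finset.sum_eq_single 0 (fun k _ hk0 => hk k hk0) fun h0 => ?_
    simpa using h0
  have hmem : y ∈ LinearMap.range (ExteriorAlgebra.ι R : M →ₗ[R] ExteriorAlgebra R M) ^ 0 := by
    rw [hy1]; exact (DirectSum.decompose 𝒜 y 0).2
  rw [pow_zero] at hmem
  obtain ⟨c, hc⟩ := Submodule.mem_one.1 hmem
  exact ⟨c, hc.symm⟩

/-- Both sides are antiderivations in `x`, vanish on scalars, and agree on vectors by the Clifford
relation. This turns graded commutation with vectors into vanishing contractions. -/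
theorem ι_mul_sub_involute_mul_ι {Q : QuadraticForm R M} (v : M) (x : CliffordAlgebra Q) :
    CliffordAlgebra.ι Q v * x - involute x * CliffordAlgebra.ι Q v
      = contractLeft (Q.polarBilin v) x := by
  induction x using CliffordAlgebra.left_induction with
  | algebraMap r => simp [Algebra.commutes, contractLeft_algebraMap]
  | add x y hx hy => rw [map_add, map_add, ← hx, ← hy, mul_add, add_mul]; abel
  | ι_mul x m hx =>
    rw [contractLeft_ι_mul, ← hx, map_mul, involute_ι, QuadraticMap.polarBilin_apply_apply,
      Algebra.smul_def, ← CliffordAlgebra.ι_mul_ι_add_swap]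
    noncomm_ring

/-- The graded centre of the Clifford algebra of a form with an orthogonal basis of anisotropic
vectors consists of scalars. -/
theorem mem_range_algebraMap_of_graded_comm [CharZero R] [Invertible (2 : R)]
    (E : Module.Basis ι R M) {Q : QuadraticForm R M} {a : R} (ha : a ≠ 0)
    (hE : ∀ i, Q.polarBilin (E i) = a • E.coord i) {x : CliffordAlgebra Q}
    (h : ∀ i, involute x * CliffordAlgebra.ι Q (E i) = CliffordAlgebra.ι Q (E i) * x) :
    ∃ c : R, x = algebraMap R _ c := by
  refine mem_range_algebraMap_of_contractLeft_eq_zero E fun i => ?_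
  have := ι_mul_sub_involute_mul_ι (E i) x
  rw [h i, sub_self, hE i, map_smul, LinearMap.smul_apply] at this
  exact (smul_eq_zero.1 this.symm).resolve_left ha

theorem mem_even_of_involute_eq [Invertible (2 : R)] {Q : QuadraticForm R M} {x : CliffordAlgebra Q}
    (h : involute x = x) : x ∈ CliffordAlgebra.even Q := by
  have hx : x ∈ evenOdd Q 0 ⊔ evenOdd Q 1 := by
    rw [(evenOdd_isCompl Q).sup_eq_top]; trivial
  obtain ⟨y, hy, z, hz, rfl⟩ := Submodule.mem_sup.1 hx
  rw [map_add, involute_eq_of_mem_even hy, involute_eq_of_mem_odd hz] at h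
  have hz0 : z = 0 := by
    have h2 : (2 : R) • z = 0 := by
      rw [two_smul]
      nth_rewrite 1 [← add_left_cancel h]
      exact neg_add_cancel z
    exact (smul_eq_zero.1 h2).resolve_left (Invertible.ne_zero 2)
  rw [hz0, add_zero]
  exact hy

end Clifford

/-! ### The Clifford algebra as a Hausdorff topological algebra -/

section CliffordTopology

variable {V : Type*} [AddCommGroup V] [Module ℂ V] [FiniteDimensional ℂ V] (q : QuadraticForm ℂ V)

instance : IsModuleTopology ℂ (Cl q) := ⟨rfl⟩

instance : Module.Finite ℂ (Cl q) := finite_cliffordAlgebra _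

instance : IsTopologicalRing (Cl q) := IsModuleTopology.isTopologicalRing ℂ _

instance : ContinuousSMul ℂ (Cl q) := IsModuleTopology.toContinuousSMul ℂ _

instance : T2Space (Cl q) := by
  let e := (Module.finBasis ℂ (Cl q)).equivFun
  exact T2Space.of_injective_continuous e.injective
    (IsModuleTopology.continuous_of_linearMap e.toLinearMap)

end CliffordTopology

/-! ### Two-sheeted coverings -/

section TwoSheeted

open Topology

/-- A subset of `X × C` whose nonempty fibres over `X` have the form `{c, -c}` with `c ≠ -c`, and
which has local continuous sections, is a covering of `X`. -/
theorem isCoveringMap_fst_of_neg {X C : Type*} [TopologicalSpace X] [TopologicalSpace C] [T2Space C]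
    [Neg C] [ContinuousNeg C] {s : Set (X × C)}
    (hfib : ∀ x c c', (x, c) ∈ s → (x, c') ∈ s → c' = c ∨ c' = -c)
    (hneg : ∀ x c, (x, c) ∈ s → (x, -c) ∈ s) (hne : ∀ x c, (x, c) ∈ s → -c ≠ c)
    (hloc : ∀ x, ∃ σ : X → C, ∀ᶠ y in 𝓝 x, ContinuousAt σ y ∧ (y, σ y) ∈ s) :
    IsCoveringMap (fun p : s => p.1.1) := by
  classical
  intro x
  obtain ⟨σ, hσ⟩ := hloc x
  obtain ⟨U, hU, hUo, hxU⟩ := eventually_nhds_iff.1 hσ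
  have hσU : Continuous fun y : U => σ y.1 :=
    continuous_iff_continuousAt.2 fun y => (hU y.1 y.2).1.comp continuousAt_subtype_val
  have hcont : Continuous (fun p : s => p.1.1) := continuous_fst.comp continuous_subtype_val
  let Y := (fun p : s => p.1.1) ⁻¹' U
  let pr : Y → U := fun p => ⟨p.1.1.1, p.2⟩
  have hpr : Continuous pr := by fun_prop
  let c : Y → C := fun p => p.1.1.2
  have hc : Continuous c := by fun_prop
  have hYs (p : Y) : (p.1.1.1, c p) ∈ s := p.1.2
  -- The image of the section is closed, and its complement over `U` is the image of the negated
  -- section, closed for the same reason.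
  have hclopen : IsClopen {p : Y | c p = σ (pr p)} := by
    refine ⟨isClosed_eq hc (hσU.comp hpr), ?_⟩
    rw [← isClosed_compl_iff]
    have : {p : Y | c p = σ (pr p)}ᶜ = {p : Y | c p = - σ (pr p)} := by
      ext p
      have h := hfib _ _ _ (hU _ p.2).2 (hYs p)
      refine ⟨fun hp => h.resolve_left hp, fun hp hp' => ?_⟩
      exact hne _ _ (hU _ p.2).2 (Eq.trans (Eq.symm hp) hp')
    rw [this]
    exact isClosed_eq hc (hσU.comp hpr).neg
  let H : Y ≃ₜ U × Bool :=
    { toFun := fun p => (pr p, decide (c p = σ (pr p)))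
      invFun := fun z => ⟨⟨(z.1.1, bif z.2 then σ z.1.1 else - σ z.1.1), by
        rcases z with ⟨y, b⟩
        cases b
        · exact hneg _ _ (hU _ y.2).2
        · exact (hU _ y.2).2⟩, z.1.2⟩
      left_inv := fun p => by
        refine Subtype.ext (Subtype.ext (Prod.ext rfl ?_))
        by_cases hp : c p = σ (pr p)
        · simp only [hp, decide_true, cond_true]
          exact hp.symm
        · simp only [hp, decide_false, cond_false]
          exact ((hfib _ _ _ (hU _ p.2).2 (hYs p)).resolve_left hp).symm
      right_inv := fun z => by
        rcases z with ⟨y, b⟩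
        refine Prod.ext rfl ?_
        cases b
        · exact decide_eq_false (hne _ _ (hU _ y.2).2)
        · exact decide_eq_true rfl
      continuous_toFun := hpr.prodMk <| by
        rw [continuous_bool_rng true]
        convert hclopen using 1
        ext p
        simp
      continuous_invFun := by
        refine Continuous.subtype_mk (Continuous.subtype_mk (Continuous.prodMk (by fun_prop) ?_) _) _
        refine continuous_prod_of_discrete_right.2 fun b => ?_
        cases b
        · exact hσU.neg
        · exact hσU }
  have : IsEvenlyCovered (fun p : s => p.1.1) x Bool :=
    ⟨inferInstance, U, hxU, hUo, hUo.preimage hcont, H, fun _ => rfl⟩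
  exact this.to_isEvenlyCovered_preimage

end TwoSheeted

/-! ### The double covering of the real orthogonal group by pin elements -/

section Pin

open CliffordAlgebra Topology
open scoped InnerProductSpace

variable {n : ℕ} {V : Type*} [AddCommGroup V] [Module ℂ V] {q : QuadraticForm ℂ V}

/-- `E` is an orthonormal basis for the complex quadratic form `q`. -/
def IsOrthonormalFor (q : QuadraticForm ℂ V) (E : Module.Basis (Fin n) ℂ V) : Prop :=
  ∀ x : Fin n → ℂ, q (∑ i, x i • E i) = ∑ i, x i ^ 2

local notation "𝔽" => EuclideanSpace ℝ (Fin n)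

/-- The real vector with the given coordinates. -/
def realVec (E : Module.Basis (Fin n) ℂ V) (v : EuclideanSpace ℝ (Fin n)) : V :=
  ∑ i, (v i : ℂ) • E i

theorem realVec_single (E : Module.Basis (Fin n) ℂ V) (i : Fin n) :
    realVec E (EuclideanSpace.single i 1) = E i := by
  simp [realVec]

variable (q) in
/-- A real vector in the Clifford algebra. -/
def γ (E : Module.Basis (Fin n) ℂ V) (v : EuclideanSpace ℝ (Fin n)) : Cl q :=
  CliffordAlgebra.ι (-q) (realVec E v)

variable {E : Module.Basis (Fin n) ℂ V}

theorem γ_add (v w : 𝔽) : γ q E (v + w) = γ q E v + γ q E w := by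
  simp [γ, realVec, add_smul, Finset.sum_add_distrib]

theorem γ_smul (c : ℝ) (v : 𝔽) : γ q E (c • v) = (c : ℂ) • γ q E v := by
  simp only [γ, realVec, PiLp.smul_apply, smul_eq_mul, Complex.ofReal_mul, mul_smul,
    ← Finset.smul_sum, map_smul]

theorem γ_neg (v : 𝔽) : γ q E (-v) = - γ q E v := by
  simp [γ, realVec]

theorem γ_sub (v w : 𝔽) : γ q E (v - w) = γ q E v - γ q E w := by
  rw [sub_eq_add_neg, γ_add, γ_neg, sub_eq_add_neg]

theorem q_realVec (hE : IsOrthonormalFor q E) (v : 𝔽) : q (realVec E v) = ((‖v‖ ^ 2 : ℝ) : ℂ) := by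
  rw [realVec, hE, EuclideanSpace.norm_sq_eq]
  push_cast
  simp [← Complex.ofReal_pow]

theorem γ_mul_self (hE : IsOrthonormalFor q E) (v : 𝔽) :
    γ q E v * γ q E v = algebraMap ℂ _ (-((‖v‖ ^ 2 : ℝ) : ℂ)) := by
  rw [γ, ι_sq_scalar, neg_apply, q_realVec hE]

theorem γ_mul_self_of_norm_one (hE : IsOrthonormalFor q E) {v : 𝔽} (hv : ‖v‖ = 1) :
    γ q E v * γ q E v = -1 := by
  rw [γ_mul_self hE, hv]
  simp

theorem γ_mul_add_swap (hE : IsOrthonormalFor q E) (v w : 𝔽) :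
    γ q E v * γ q E w + γ q E w * γ q E v = algebraMap ℂ _ ((-2 * ⟪v, w⟫_ℝ : ℝ) : ℂ) := by
  have h := γ_mul_self hE (v + w)
  rw [γ_add, norm_add_sq_real] at h
  have h1 := γ_mul_self hE v
  have h2 := γ_mul_self hE w
  have : γ q E v * γ q E w + γ q E w * γ q E v = (γ q E v + γ q E w) * (γ q E v + γ q E w)
      - γ q E v * γ q E v - γ q E w * γ q E w := by noncomm_ring
  rw [this, h, h1, h2, ← map_sub, ← map_sub]
  congr 1
  push_cast
  ring

theorem continuous_γ [FiniteDimensional ℂ V] : Continuous (γ q E) := by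
  have h : γ q E = fun v => ∑ i, (v i : ℂ) • CliffordAlgebra.ι (-q) (E i) := by
    funext v
    simp only [γ, realVec, map_sum, map_smul]
  rw [h]
  fun_prop

/-- An orthonormal basis is dual to itself up to the factor `-2`: the `2` comes from polarization,
the sign from the convention `v² = -q(v)`. This is the hypothesis under which the graded centre was
computed. -/
theorem polarBilin_basis (hE : IsOrthonormalFor q E) (i : Fin n) :
    (-q).polarBilin (E i) = (-2 : ℂ) • E.coord i := by
  classical
  refine E.ext fun j => ?_
  have h1 (k : Fin n) : q (E k) = 1 := by
    have := hE (Pi.single k 1)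
    simpa [Pi.single_apply] using this
  have h2 : q (E i + E j) = ∑ k, ((Pi.single i 1 + Pi.single j 1 : Fin n → ℂ) k) ^ 2 := by
    rw [← hE]
    simp [Pi.single_apply, add_smul, Finset.sum_add_distrib]
  rw [QuadraticMap.polarBilin_apply_apply, QuadraticMap.polar, neg_apply,
    neg_apply, neg_apply, h1, h1, h2]
  have h3 : ∑ k, ((Pi.single i 1 + Pi.single j 1 : Fin n → ℂ) k) ^ 2
      = 2 + 2 * if i = j then 1 else 0 := by
    have : ∀ k, ((Pi.single i 1 + Pi.single j 1 : Fin n → ℂ) k) ^ 2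
        = (if k = i then 1 else 0) + (if k = j then 1 else 0)
          + 2 * (if k = i then (if i = j then 1 else 0) else 0) := by
      intro k
      simp only [Pi.add_apply, Pi.single_apply]
      split_ifs <;> (simp_all; try norm_num)
    rw [Finset.sum_congr rfl fun k _ => this k]
    simp only [Finset.sum_add_distrib, ← Finset.mul_sum, Finset.sum_ite_eq', Finset.mem_univ, if_true]
    norm_num
  rw [h3]
  by_cases hij : i = j
  · subst hij
    simp
    norm_num
  · simp [hij]
    norm_num

/-- The reflection in the hyperplane orthogonal to the unit vector `u`. -/
def reflOp (u : EuclideanSpace ℝ (Fin n)) :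
    EuclideanSpace ℝ (Fin n) →L[ℝ] EuclideanSpace ℝ (Fin n) :=
  1 - (2 : ℝ) • (innerSL ℝ u).smulRight u

theorem reflOp_apply (u v : 𝔽) : reflOp u v = v - (2 * ⟪u, v⟫_ℝ) • u := by
  simp [reflOp, smul_smul]

theorem continuous_reflOp : Continuous (reflOp : 𝔽 → 𝔽 →L[ℝ] 𝔽) := by
  have h : Continuous fun u : 𝔽 => (innerSL ℝ u).smulRight u :=
    ((ContinuousLinearMap.smulRightL ℝ 𝔽 𝔽).continuous.comp (innerSL ℝ).continuous).clm_apply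
      continuous_id
  exact continuous_const.sub (h.const_smul (2 : ℝ))

theorem reflOp_eq_reflection {u : 𝔽} (hu : ‖u‖ = 1) (v : 𝔽) :
    reflOp u v = (ℝ ∙ u)ᗮ.reflection v := by
  rw [reflOp_apply, Submodule.reflection_orthogonal_apply, Submodule.reflection_singleton_apply, hu]
  simp [two_smul, two_mul, add_smul]

theorem norm_reflOp {u : 𝔽} (hu : ‖u‖ = 1) (v : 𝔽) : ‖reflOp u v‖ = ‖v‖ := by
  rw [reflOp_eq_reflection hu, LinearIsometryEquiv.norm_map]

theorem det_reflOp {u : 𝔽} (hu : ‖u‖ = 1) :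
    LinearMap.det (reflOp u : 𝔽 →ₗ[ℝ] 𝔽) = -1 := by
  have h : (reflOp u : 𝔽 →ₗ[ℝ] 𝔽) = ((ℝ ∙ u)ᗮ.reflection).toLinearMap :=
    LinearMap.ext fun v => reflOp_eq_reflection hu v
  have hu0 : u ≠ 0 := by
    rintro rfl
    simp at hu
  rw [h, Submodule.det_reflection, Submodule.orthogonal_orthogonal, finrank_span_singleton hu0,
    pow_one]

theorem reflOp_reflOp {u : 𝔽} (hu : ‖u‖ = 1) (v : 𝔽) : reflOp u (reflOp u v) = v := by
  rw [reflOp_eq_reflection hu, reflOp_eq_reflection hu, Submodule.reflection_reflection]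

theorem reflOp_eq_self_of_inner {u v : 𝔽} (h : ⟪u, v⟫_ℝ = 0) : reflOp u v = v := by
  rw [reflOp_apply, h]; simp

variable (q E) in
/-- The pairs consisting of an isometry of `ℝⁿ` and an element of the complex pin group acting
as this isometry on real vectors. -/
def pinPairs : Submonoid
    ((EuclideanSpace ℝ (Fin n) →L[ℝ] EuclideanSpace ℝ (Fin n)) × Cl q) where
  carrier := {p | (∀ v, ‖p.1 v‖ = ‖v‖) ∧ p.2 ∈ pinGroup (-q) ∧
    (∀ v, involute p.2 * γ q E v = γ q E (p.1 v) * p.2) ∧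
    involute p.2 = ((LinearMap.det (p.1 : 𝔽 →ₗ[ℝ] 𝔽) : ℝ) : ℂ) • p.2}
  one_mem' := by
    refine ⟨fun v => rfl, one_mem _, fun v => ?_, ?_⟩
    · change involute 1 * γ q E v = γ q E v * 1
      simp
    · change involute 1 = ((LinearMap.det (LinearMap.id : 𝔽 →ₗ[ℝ] 𝔽) : ℝ) : ℂ) • 1
      simp
  mul_mem' := by
    rintro ⟨a, x⟩ ⟨b, y⟩ ⟨ha, hx, hax, hdx⟩ ⟨hb, hy, hby, hdy⟩
    refine ⟨fun v => (ha _).trans (hb v), mul_mem hx hy, fun v => ?_, ?_⟩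
    · change involute (x * y) * γ q E v = γ q E (a (b v)) * (x * y)
      rw [map_mul, mul_assoc, hby, ← mul_assoc, hax, mul_assoc]
    · change involute (x * y) = ((LinearMap.det ((a : 𝔽 →ₗ[ℝ] 𝔽) * (b : 𝔽 →ₗ[ℝ] 𝔽)) : ℝ) : ℂ)
        • (x * y)
      rw [map_mul, hdx, hdy, map_mul]
      rw [Complex.ofReal_mul, smul_mul_smul_comm]

theorem mk_mul_mem_pinPairs {a b : 𝔽 →L[ℝ] 𝔽} {x y : Cl q} (h : (a, x) ∈ pinPairs q E)
    (h' : (b, y) ∈ pinPairs q E) : (a * b, x * y) ∈ pinPairs q E := by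
  have := mul_mem h h'
  rwa [Prod.mk_mul_mk] at this

theorem γ_mem_pinGroup (hE : IsOrthonormalFor q E) {u : 𝔽} (hu : ‖u‖ = 1) :
    γ q E u ∈ pinGroup (-q) := by
  have hsq := γ_mul_self_of_norm_one hE hu
  have hinv : γ q E u * -γ q E u = 1 := by rw [mul_neg, hsq, neg_neg]
  have hinv' : -γ q E u * γ q E u = 1 := by rw [neg_mul, hsq, neg_neg]
  refine pinGroup.mem_iff.2 ⟨?_, ?_⟩
  · refine ⟨⟨γ q E u, -γ q E u, hinv, hinv'⟩, ?_, rfl⟩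
    exact Subgroup.subset_closure ⟨realVec E u, rfl⟩
  · have : star (γ q E u) = -γ q E u := by rw [γ, star_ι]
    exact Unitary.mem_iff.2 ⟨by rw [this, hinv'], by rw [this, hinv]⟩

/-- Twisted conjugation by a unit vector is a reflection: from `uv + vu = -2⟪u, v⟫` and `u² = -1`
one gets `-uv = (v - 2⟪u, v⟫u)u`. -/
theorem reflOp_mem_pinPairs (hE : IsOrthonormalFor q E) {u : 𝔽} (hu : ‖u‖ = 1) :
    (reflOp u, γ q E u) ∈ pinPairs q E := by
  refine ⟨norm_reflOp hu, γ_mem_pinGroup hE hu, fun v => ?_, ?_⟩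
  · have h := γ_mul_add_swap hE u v
    have hinv : involute (γ q E u) = - γ q E u := by rw [γ, involute_ι]
    have h2 : γ q E (reflOp u v) = γ q E v - ((2 * ⟪u, v⟫_ℝ : ℝ) : ℂ) • γ q E u := by
      rw [reflOp_apply, γ_sub, γ_smul]
    have h3 : γ q E v * γ q E u =
        algebraMap ℂ _ ((-2 * ⟪u, v⟫_ℝ : ℝ) : ℂ) - γ q E u * γ q E v := by
      rw [← h]; abel
    change involute (γ q E u) * γ q E v = γ q E (reflOp u v) * γ q E u
    rw [hinv, h2, sub_mul, smul_mul_assoc, γ_mul_self_of_norm_one hE hu, h3,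
      Algebra.algebraMap_eq_smul_one]
    have h4 : (((-2 * ⟪u, v⟫_ℝ : ℝ)) : ℂ) = - ((2 * ⟪u, v⟫_ℝ : ℝ) : ℂ) := by push_cast; ring
    rw [h4, neg_smul, smul_neg, neg_mul]
    abel
  · change involute (γ q E u) = ((LinearMap.det (reflOp u : 𝔽 →ₗ[ℝ] 𝔽) : ℝ) : ℂ) • γ q E u
    rw [det_reflOp hu, γ, involute_ι]
    simp

/-- A unit vector squares to `-1`, while its reflection squares to the identity. A unit vector
exists only because `n ≠ 0`. -/
theorem neg_one_mem_pinPairs [NeZero n] (hE : IsOrthonormalFor q E) :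
    (1, -1) ∈ pinPairs q E := by
  have hu : ‖(EuclideanSpace.single 0 1 : 𝔽)‖ = 1 := by simp
  have := mul_mem (reflOp_mem_pinPairs hE hu) (reflOp_mem_pinPairs hE hu)
  convert this using 2
  · ext1 v
    change v = reflOp _ (reflOp _ v)
    rw [reflOp_reflOp hu]
  · exact (γ_mul_self_of_norm_one hE hu).symm

theorem neg_mem_pinPairs [NeZero n] (hE : IsOrthonormalFor q E) {a : 𝔽 →L[ℝ] 𝔽} {x : Cl q}
    (h : (a, x) ∈ pinPairs q E) : (a, -x) ∈ pinPairs q E := by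
  have := mul_mem (neg_one_mem_pinPairs hE) h
  simpa using this

theorem neg_ne_of_mem_pinPairs {a : 𝔽 →L[ℝ] 𝔽} {x : Cl q} (h : (a, x) ∈ pinPairs q E) :
    -x ≠ x := by
  intro hx
  have h0 : x = 0 := by
    have h2 : (2 : ℂ) • x = 0 := by
      rw [two_smul]
      nth_rewrite 1 [← hx]
      exact neg_add_cancel x
    exact (smul_eq_zero.1 h2).resolve_left two_ne_zero
  have := pinGroup.star_mul_self_of_mem h.2.1
  rw [h0, mul_zero] at this
  exact zero_ne_one this

/-- The element `star x * y = x⁻¹y` graded-commutes with all basis vectors, hence is a scalar `c`.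
Scalars are fixed by `star`, so unitarity says `c² = 1`. -/
theorem eq_or_eq_neg_of_mem_pinPairs (hE : IsOrthonormalFor q E) {a : 𝔽 →L[ℝ] 𝔽} {x y : Cl q}
    (hx : (a, x) ∈ pinPairs q E) (hy : (a, y) ∈ pinPairs q E) : y = x ∨ y = -x := by
  obtain ⟨-, hx1, hx2, -⟩ := hx
  obtain ⟨-, hy1, hy2, -⟩ := hy
  have h1 := pinGroup.star_mul_self_of_mem hx1
  have h1' := pinGroup.mul_star_self_of_mem hx1
  have hz : star x * y ∈ pinGroup (-q) := mul_mem (pinGroup.star_mem hx1) hy1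
  have key (i : Fin n) : involute (star x * y) * CliffordAlgebra.ι (-q) (E i)
      = CliffordAlgebra.ι (-q) (E i) * (star x * y) := by
    have e1 := hx2 (EuclideanSpace.single i 1)
    have e2 := hy2 (EuclideanSpace.single i 1)
    have e0 : γ q E (EuclideanSpace.single i 1) = CliffordAlgebra.ι (-q) (E i) := by
      rw [γ, realVec_single]
    rw [e0] at e1 e2
    dsimp only at e1 e2
    have h2 : involute (star x) * involute x = 1 := by rw [← map_mul, h1, map_one]
    have e3 : CliffordAlgebra.ι (-q) (E i) * star x
        = involute (star x) * γ q E (a (EuclideanSpace.single i 1)) := by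
      calc CliffordAlgebra.ι (-q) (E i) * star x
          = involute (star x) * (involute x * CliffordAlgebra.ι (-q) (E i)) * star x := by
            rw [← mul_assoc, h2, one_mul]
        _ = _ := by rw [e1, mul_assoc, mul_assoc, h1', mul_one]
    rw [map_mul, mul_assoc, e2, ← mul_assoc, ← mul_assoc, e3]
  obtain ⟨c, hc⟩ := mem_range_algebraMap_of_graded_comm E (a := (-2 : ℂ)) (by norm_num)
    (polarBilin_basis hE) key
  have hc2 := pinGroup.star_mul_self_of_mem hz
  rw [hc, star_algebraMap, ← map_mul, ← map_one (algebraMap ℂ (Cl q))] at hc2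
  have hc3 : c * c = 1 := (algebraMap ℂ (Cl q)).injective hc2
  have hy' : y = x * algebraMap ℂ _ c := by rw [← hc, ← mul_assoc, h1', one_mul]
  rcases mul_self_eq_one_iff.1 hc3 with rfl | rfl
  · left; rw [hy', map_one, mul_one]
  · right; rw [hy', map_neg, map_one, mul_neg_one]

/-- Given unit vectors `v`, `w`, an element of the pin group that maps `v` to `w`, and fixes the
vectors orthogonal to both. -/
theorem rotation_mem_pinPairs (hE : IsOrthonormalFor q E) {v w : 𝔽} (hv : ‖v‖ = 1)
    (hvw : v + w ≠ 0) :
    (reflOp (‖v + w‖⁻¹ • (v + w)), γ q E (‖v + w‖⁻¹ • (v + w))) * (reflOp v, γ q E v)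
      ∈ pinPairs q E := by
  refine mul_mem (reflOp_mem_pinPairs hE ?_) (reflOp_mem_pinPairs hE hv)
  rw [norm_smul, norm_inv, norm_norm]
  exact inv_mul_cancel₀ (norm_ne_zero_iff.2 hvw)

/-- The first reflection sends `v` to `-v`, and the reflection along `v + w` exchanges `-v` and `w`,
since `v` and `w` have equal length. -/
theorem rotation_apply {v w : 𝔽} (hv : ‖v‖ = 1) (hw : ‖w‖ = 1) (hvw : v + w ≠ 0) :
    reflOp (‖v + w‖⁻¹ • (v + w)) (reflOp v v) = w := by
  have h1 : reflOp v v = -v := by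
    rw [reflOp_apply, real_inner_self_eq_norm_sq, hv]
    module
  have h2 : ‖v + w‖ ^ 2 = 2 + 2 * ⟪v, w⟫_ℝ := by rw [norm_add_sq_real, hv, hw]; ring
  have h3 : ‖v + w‖ ≠ 0 := norm_ne_zero_iff.2 hvw
  rw [h1, reflOp_apply, inner_smul_left, inner_neg_right, inner_add_left,
    real_inner_self_eq_norm_sq, hv, real_inner_comm, smul_smul]
  have h4 : 2 * ((starRingEnd ℝ) ‖v + w‖⁻¹ * -(1 ^ 2 + ⟪v, w⟫_ℝ)) * ‖v + w‖⁻¹ = -1 := by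
    rw [conj_trivial]
    field_simp
    rw [h2]
    ring
  rw [h4]
  module

theorem inner_eq_of_norm_eq {a : 𝔽 →L[ℝ] 𝔽} (ha : ∀ v, ‖a v‖ = ‖v‖) (v w : 𝔽) :
    ⟪a v, a w⟫_ℝ = ⟪v, w⟫_ℝ :=
  (⟨a, ha⟩ : 𝔽 →ₗᵢ[ℝ] 𝔽).inner_map_map v w

/-- By Cartan-Dieudonné an isometry is a product of reflections, and each reflection lifts to its
unit vector. -/
theorem exists_mem_pinPairs (hE : IsOrthonormalFor q E) {a : 𝔽 →L[ℝ] 𝔽} (ha : ∀ v, ‖a v‖ = ‖v‖) :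
    ∃ x, (a, x) ∈ pinPairs q E := by
  let φ : 𝔽 ≃ₗᵢ[ℝ] 𝔽 := LinearIsometry.toLinearIsometryEquiv ⟨a, ha⟩ rfl
  obtain ⟨l, -, hl⟩ := φ.reflections_generate_dim
  suffices ∀ (l : List 𝔽) (b : 𝔽 →L[ℝ] 𝔽),
      (∀ v, b v = (l.map fun v => (ℝ ∙ v)ᗮ.reflection).prod v) → ∃ x, (b, x) ∈ pinPairs q E by
    refine this l a fun v => ?_
    rw [← hl]
    rfl
  intro l
  induction l with
  | nil =>
    intro b hb
    have : b = 1 := by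
      ext1 v
      rw [hb]
      rfl
    exact ⟨1, this ▸ one_mem (pinPairs q E)⟩
  | cons u l ih =>
    intro b hb
    obtain ⟨x, hx⟩ := ih ((l.map fun v => (ℝ ∙ v)ᗮ.reflection).prod :
      𝔽 ≃ₗᵢ[ℝ] 𝔽).toContinuousLinearEquiv fun v => rfl
    -- The list of reflecting vectors may contain zero, whose reflection is the identity and
    -- contributes no factor.
    by_cases hu : u = 0
    · refine ⟨x, ?_⟩
      convert hx using 2
      ext1 v
      rw [hb, List.map_cons, List.prod_cons, hu]
      change (ℝ ∙ (0 : 𝔽))ᗮ.reflection _ = _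
      rw [Submodule.reflection_mem_subspace_eq_self]
      · rfl
      · simp
    · have hu1 : ‖‖u‖⁻¹ • u‖ = 1 := by
        rw [norm_smul, norm_inv, norm_norm]
        exact inv_mul_cancel₀ (norm_ne_zero_iff.2 hu)
      have hmul := mul_mem (reflOp_mem_pinPairs hE hu1) hx
      refine ⟨γ q E (‖u‖⁻¹ • u) * x, ?_⟩
      convert hmul using 1
      rw [Prod.mk_mul_mk]
      congr 1
      ext1 v
      rw [hb, List.map_cons, List.prod_cons]
      change _ = reflOp (‖u‖⁻¹ • u) _
      rw [reflOp_eq_reflection hu1]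
      have hspan : (ℝ ∙ (‖u‖⁻¹ • u)) = ℝ ∙ u :=
        Submodule.span_singleton_smul_eq (isUnit_iff_ne_zero.2
          (inv_ne_zero (norm_ne_zero_iff.2 hu))) u
      simp only [hspan]
      rfl

/-- Start from the constant lift of `f x₀` and correct the values on the basis vectors one at a
time. Each correction is a product of two reflections depending continuously on `x`, with an
explicit lift to a product of two unit vectors. -/
theorem exists_local_section_pinPairs [FiniteDimensional ℂ V] (hE : IsOrthonormalFor q E)
    {X : Type*} [TopologicalSpace X]
    {f : X → 𝔽 →L[ℝ] 𝔽} (hf : Continuous f) (hiso : ∀ x v, ‖f x v‖ = ‖v‖) (x₀ : X) :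
    ∃ σ : X → Cl q, ∀ᶠ x in 𝓝 x₀, ContinuousAt σ x ∧ (f x, σ x) ∈ pinPairs q E := by
  let b : Fin n → 𝔽 := fun i => EuclideanSpace.single i 1
  have hb1 (i : Fin n) : ‖b i‖ = 1 := by simp [b]
  have hb2 (i j : Fin n) (h : i ≠ j) : ⟪b i, b j⟫_ℝ = 0 := by
    simp [b, EuclideanSpace.inner_single_left, h]
  -- The condition `A x₀ = f x₀` is kept through the induction so that the current and the desired
  -- value of the next basis vector coincide at `x₀`; their sum is then nonzero near `x₀`, as the
  -- rotation requires.
  suffices ∀ k ≤ n, ∃ (A : X → 𝔽 →L[ℝ] 𝔽) (σ : X → Cl q), A x₀ = f x₀ ∧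
      ∀ᶠ x in 𝓝 x₀, ContinuousAt A x ∧ ContinuousAt σ x ∧ (A x, σ x) ∈ pinPairs q E ∧
        ∀ i : Fin n, i.1 < k → A x (b i) = f x (b i) by
    obtain ⟨A, σ, -, h⟩ := this n le_rfl
    refine ⟨σ, h.mono fun x ⟨_, hσ, hmem, hA⟩ => ⟨hσ, ?_⟩⟩
    have : A x = f x := by
      refine ContinuousLinearMap.coe_injective ((EuclideanSpace.basisFun (Fin n) ℝ).toBasis.ext
        fun i => ?_)
      simpa using hA i i.2
    rwa [← this]
  intro k
  induction k with
  | zero =>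
    intro _
    obtain ⟨c, hc⟩ := exists_mem_pinPairs hE (hiso x₀)
    exact ⟨fun _ => f x₀, fun _ => c, rfl, Filter.Eventually.of_forall fun x =>
      ⟨continuousAt_const, continuousAt_const, hc, fun i hi => absurd hi (Nat.not_lt_zero _)⟩⟩
  | succ k ih =>
    intro hk
    obtain ⟨A, σ, hA0, hA⟩ := ih (Nat.le_of_succ_le hk)
    let j : Fin n := ⟨k, hk⟩
    let v : X → 𝔽 := fun x => A x (b j)
    let w : X → 𝔽 := fun x => f x (b j)
    have hv (x : X) (hx : ContinuousAt A x) : ContinuousAt v x := hx.clm_apply continuousAt_const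
    have hw (x : X) : ContinuousAt w x := hf.continuousAt.clm_apply continuousAt_const
    let u : X → 𝔽 := fun x => ‖v x + w x‖⁻¹ • (v x + w x)
    have hw1 (x : X) : ‖w x‖ = 1 := (hiso x _).trans (hb1 j)
    have hv0 : v x₀ = w x₀ := by simp only [v, w, hA0]
    have hne : v x₀ + w x₀ ≠ 0 := by
      rw [hv0, ← two_smul ℝ]
      refine smul_ne_zero two_ne_zero (norm_ne_zero_iff.1 ?_)
      rw [hw1]
      exact one_ne_zero
    have hu0 : u x₀ = w x₀ := by
      simp only [u]
      rw [hv0, ← two_smul ℝ, norm_smul, hw1, smul_smul]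
      norm_num
    have hne' : ∀ᶠ x in 𝓝 x₀, v x + w x ≠ 0 :=
      ((hv x₀ hA.self_of_nhds.1).add (hw x₀)).eventually_ne hne
    refine ⟨fun x => reflOp (u x) * (reflOp (v x) * A x),
      fun x => γ q E (u x) * (γ q E (v x) * σ x), ?_, ?_⟩
    · ext1 z
      change reflOp (u x₀) (reflOp (v x₀) (A x₀ z)) = f x₀ z
      rw [hu0, hv0, hA0, reflOp_reflOp (hw1 x₀)]
    filter_upwards [hA, hne'] with x ⟨hAx, hσ, hmem, hag⟩ hx
    have hv1 : ‖v x‖ = 1 := (hmem.1 _).trans (hb1 j)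
    have hvx := hv x hAx
    have hux : ContinuousAt u x :=
      (((hvx.add (hw x)).norm).inv₀ (norm_ne_zero_iff.2 hx)).smul (hvx.add (hw x))
    refine ⟨?_, ?_, ?_, ?_⟩
    · exact (continuous_reflOp.continuousAt.comp hux).mul
        ((continuous_reflOp.continuousAt.comp hvx).mul hAx)
    · exact (continuous_γ.continuousAt.comp hux).mul ((continuous_γ.continuousAt.comp hvx).mul hσ)
    · have := mul_mem (rotation_mem_pinPairs hE hv1 hx) hmem
      rw [mul_assoc] at this
      exact this
    · intro i hi
      change reflOp (u x) (reflOp (v x) (A x (b i))) = f x (b i)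
      -- The values already corrected are orthogonal to both the old and the new value of the next
      -- basis vector, because `A x` and `f x` are isometries. Both reflections therefore fix them.
      rcases Nat.lt_succ_iff_lt_or_eq.1 hi with hi | hi
      · have hij : j ≠ i := fun h => by
          rw [← h] at hi
          exact lt_irrefl _ hi
        have e1 : ⟪v x, f x (b i)⟫_ℝ = 0 := by
          rw [← hag i hi]
          exact (inner_eq_of_norm_eq hmem.1 _ _).trans (hb2 _ _ hij)
        have e2 : ⟪w x, f x (b i)⟫_ℝ = 0 :=
          (inner_eq_of_norm_eq (hiso x) _ _).trans (hb2 _ _ hij)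
        rw [hag i hi, reflOp_eq_self_of_inner e1]
        refine reflOp_eq_self_of_inner ?_
        simp only [u]
        rw [inner_smul_left, inner_add_left, e1, e2]
        simp
      · have : i = j := Fin.ext hi
        subst this
        exact rotation_apply hv1 (hw1 x) hx

/-- The pullback of the pin covering of the orthogonal group along the map `f`. -/
def pinCover {X : Type*} (E : Module.Basis (Fin n) ℂ V) (q : QuadraticForm ℂ V)
    (f : X → EuclideanSpace ℝ (Fin n) →L[ℝ] EuclideanSpace ℝ (Fin n)) : Set (X × Cl q) :=
  {p | (f p.1, p.2) ∈ pinPairs q E}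

theorem isCoveringMap_pinCover [FiniteDimensional ℂ V] [NeZero n] (hE : IsOrthonormalFor q E)
    {X : Type*} [TopologicalSpace X]
    {f : X → 𝔽 →L[ℝ] 𝔽} (hf : Continuous f) (hiso : ∀ x v, ‖f x v‖ = ‖v‖) :
    IsCoveringMap (fun p : pinCover E q f => p.1.1) :=
  isCoveringMap_fst_of_neg (fun _ _ _ h h' => eq_or_eq_neg_of_mem_pinPairs hE h h')
    (fun _ _ h => neg_mem_pinPairs hE h) (fun _ _ h => neg_ne_of_mem_pinPairs h)
    (exists_local_section_pinPairs hE hf hiso)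

end Pin

/-! ### The orthogonal part of an invertible operator -/

section OrthogonalPart

open Topology InnerProductSpace
open scoped InnerProductSpace

theorem gramSchmidt_eq_sub_sum {ι H : Type*} [LinearOrder ι] [LocallyFiniteOrderBot ι]
    [WellFoundedLT ι] [NormedAddCommGroup H] [InnerProductSpace ℝ H] (f : ι → H) (i : ι) :
    gramSchmidt ℝ f i = f i - ∑ j ∈ Finset.Iio i,
      (⟪gramSchmidt ℝ f j, f i⟫_ℝ / ‖gramSchmidt ℝ f j‖ ^ 2) • gramSchmidt ℝ f j := by
  rw [gramSchmidt_def]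
  simp only [Submodule.starProjection_singleton]
  rfl

/-- The straight path from the Gram-Schmidt orthonormalization of a linearly independent family to
the family stays above the straight path of orthogonalizations. -/
theorem gramSchmidt_path {ι H : Type*} [LinearOrder ι] [LocallyFiniteOrderBot ι]
    [WellFoundedLT ι] [NormedAddCommGroup H] [InnerProductSpace ℝ H] {f : ι → H}
    (hf : LinearIndependent ℝ f) {t : ℝ} (ht0 : 0 ≤ t) (ht1 : t ≤ 1) (i : ι) :
    gramSchmidt ℝ (fun i => (1 - t) • gramSchmidtNormed ℝ f i + t • f i) i
      = ((1 - t) * ‖gramSchmidt ℝ f i‖⁻¹ + t) • gramSchmidt ℝ f i := by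
  have hpos (i : ι) : 0 < (1 - t) * ‖gramSchmidt ℝ f i‖⁻¹ + t := by
    have : 0 < ‖gramSchmidt ℝ f i‖⁻¹ :=
      inv_pos.2 (norm_pos_iff.2 (gramSchmidt_ne_zero i hf))
    rcases ht0.eq_or_lt with rfl | h
    · simpa using this
    · have := mul_nonneg (sub_nonneg.2 ht1) this.le
      linarith
  have hN (i : ι) : gramSchmidtNormed ℝ f i = ‖gramSchmidt ℝ f i‖⁻¹ • gramSchmidt ℝ f i := rfl
  induction i using WellFoundedLT.induction with
  | ind i ih =>
    rw [gramSchmidt_eq_sub_sum]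
    -- By induction the earlier Gram-Schmidt vectors change only by nonzero factors, which do not
    -- affect the projections onto their lines. The normalized `i`-th vector is orthogonal to these
    -- lines, so only the summand `t • f i` is projected.
    have hterm : ∀ j ∈ Finset.Iio i,
        (⟪gramSchmidt ℝ (fun i => (1 - t) • gramSchmidtNormed ℝ f i + t • f i) j,
          (1 - t) • gramSchmidtNormed ℝ f i + t • f i⟫_ℝ /
          ‖gramSchmidt ℝ (fun i => (1 - t) • gramSchmidtNormed ℝ f i + t • f i) j‖ ^ 2) •
          gramSchmidt ℝ (fun i => (1 - t) • gramSchmidtNormed ℝ f i + t • f i) j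
        = t • ((⟪gramSchmidt ℝ f j, f i⟫_ℝ / ‖gramSchmidt ℝ f j‖ ^ 2) • gramSchmidt ℝ f j) := by
      intro j hj
      have hji := Finset.mem_Iio.1 hj
      rw [ih j hji]
      set c := (1 - t) * ‖gramSchmidt ℝ f j‖⁻¹ + t with hc
      have hc0 : c ≠ 0 := (hpos j).ne'
      have horth : ⟪gramSchmidt ℝ f j, gramSchmidt ℝ f i⟫_ℝ = 0 :=
        gramSchmidt_orthogonal ℝ f hji.ne
      have hg : ‖gramSchmidt ℝ f j‖ ≠ 0 := norm_ne_zero_iff.2 (gramSchmidt_ne_zero j hf)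
      rw [inner_add_right, inner_smul_right, inner_smul_right, hN, inner_smul_right,
        inner_smul_left, inner_smul_left, horth, norm_smul, Real.norm_eq_abs, smul_smul, smul_smul,
        mul_pow, sq_abs, conj_trivial]
      congr 1
      field_simp
      ring
    rw [Finset.sum_congr rfl hterm, ← Finset.smul_sum]
    have hfi := gramSchmidt_eq_sub_sum f i
    rw [eq_sub_iff_add_eq] at hfi
    generalize ∑ j ∈ Finset.Iio i, (⟪gramSchmidt ℝ f j, f i⟫_ℝ / ‖gramSchmidt ℝ f j‖ ^ 2) •
      gramSchmidt ℝ f j = S at hfi ⊢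
    rw [hN, ← hfi, smul_add, add_smul, mul_smul]
    abel

/-- Along the segment each orthogonalized vector is only rescaled by a positive factor, and
normalization removes it. -/
theorem gramSchmidtNormed_path {ι H : Type*} [LinearOrder ι] [LocallyFiniteOrderBot ι]
    [WellFoundedLT ι] [NormedAddCommGroup H] [InnerProductSpace ℝ H] {f : ι → H}
    (hf : LinearIndependent ℝ f) {t : ℝ} (ht0 : 0 ≤ t) (ht1 : t ≤ 1) (i : ι) :
    gramSchmidt ℝ (fun i => (1 - t) • gramSchmidtNormed ℝ f i + t • f i) i ≠ 0 ∧
    gramSchmidtNormed ℝ (fun i => (1 - t) • gramSchmidtNormed ℝ f i + t • f i) i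
      = gramSchmidtNormed ℝ f i := by
  have hg : 0 < ‖gramSchmidt ℝ f i‖ := norm_pos_iff.2 (gramSchmidt_ne_zero i hf)
  have hpos : 0 < (1 - t) * ‖gramSchmidt ℝ f i‖⁻¹ + t := by
    have h2 := inv_pos.2 hg
    rcases ht0.eq_or_lt with rfl | h
    · simpa using h2
    · have := mul_nonneg (sub_nonneg.2 ht1) h2.le
      linarith
  have h := gramSchmidt_path hf ht0 ht1 i
  refine ⟨by rw [h]; exact smul_ne_zero hpos.ne' (gramSchmidt_ne_zero i hf), ?_⟩
  change (‖gramSchmidt ℝ _ i‖⁻¹ : ℝ) • gramSchmidt ℝ _ i = (‖gramSchmidt ℝ f i‖⁻¹ : ℝ) • _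
  rw [h, norm_smul, smul_smul, Real.norm_eq_abs, abs_of_pos hpos]
  congr 1
  rw [mul_inv, mul_right_comm, inv_mul_cancel₀ hpos.ne', one_mul]

/-- The recursion divides only by norms of earlier Gram-Schmidt vectors; their being nonzero at the
single point `x` suffices. -/
theorem continuousAt_gramSchmidt {ι H X : Type*} [LinearOrder ι] [LocallyFiniteOrderBot ι]
    [WellFoundedLT ι] [NormedAddCommGroup H] [InnerProductSpace ℝ H] [TopologicalSpace X]
    {f : X → ι → H} {x : X} (hf : ∀ i, ContinuousAt (fun y => f y i) x)
    (hx : LinearIndependent ℝ (f x)) (i : ι) :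
    ContinuousAt (fun y => gramSchmidt ℝ (f y) i) x := by
  induction i using WellFoundedLT.induction with
  | ind i ih =>
    have h : (fun y => gramSchmidt ℝ (f y) i) = fun y => f y i - ∑ j ∈ Finset.Iio i,
        (⟪gramSchmidt ℝ (f y) j, f y i⟫_ℝ / ‖gramSchmidt ℝ (f y) j‖ ^ 2) •
          gramSchmidt ℝ (f y) j := funext fun y => gramSchmidt_eq_sub_sum (f y) i
    rw [h]
    refine (hf i).sub (tendsto_finsetSum _ fun j hj => ?_)
    have hj' := ih j (Finset.mem_Iio.1 hj)
    exact ((hj'.inner (hf i)).div (hj'.norm.pow 2)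
      (pow_ne_zero 2 (norm_ne_zero_iff.2 (gramSchmidt_ne_zero j hx)))).smul hj'

variable {n : ℕ}
local notation "𝔽" => EuclideanSpace ℝ (Fin n)

/-- The operator with prescribed values on the standard basis. -/
def opOfFamily (f : Fin n → EuclideanSpace ℝ (Fin n)) :
    EuclideanSpace ℝ (Fin n) →L[ℝ] EuclideanSpace ℝ (Fin n) :=
  ∑ i, (innerSL ℝ (EuclideanSpace.single i (1 : ℝ))).smulRight (f i)

theorem opOfFamily_apply (f : Fin n → 𝔽) (v : 𝔽) : opOfFamily f v = ∑ i, v i • f i := by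
  simp [opOfFamily, EuclideanSpace.inner_single_left]

theorem opOfFamily_single (f : Fin n → 𝔽) (i : Fin n) :
    opOfFamily f (EuclideanSpace.single i 1) = f i := by
  simp [opOfFamily_apply]

theorem op_ext {a b : 𝔽 →L[ℝ] 𝔽}
    (h : ∀ i, a (EuclideanSpace.single i 1) = b (EuclideanSpace.single i 1)) : a = b := by
  refine ContinuousLinearMap.coe_injective ((EuclideanSpace.basisFun (Fin n) ℝ).toBasis.ext
    fun i => ?_)
  simpa using h i

/-- The family of values of an operator on the standard basis. -/
def familyOfOp (a : EuclideanSpace ℝ (Fin n) →L[ℝ] EuclideanSpace ℝ (Fin n)) :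
    Fin n → EuclideanSpace ℝ (Fin n) := fun i => a (EuclideanSpace.single i 1)

theorem opOfFamily_familyOfOp (a : 𝔽 →L[ℝ] 𝔽) : opOfFamily (familyOfOp a) = a :=
  op_ext fun i => opOfFamily_single _ i

theorem linearIndependent_familyOfOp {a : 𝔽 →L[ℝ] 𝔽} (ha : Function.Injective a) :
    LinearIndependent ℝ (familyOfOp a) := by
  have h := (EuclideanSpace.basisFun (Fin n) ℝ).toBasis.linearIndependent.map'
    (a : 𝔽 →ₗ[ℝ] 𝔽) (LinearMap.ker_eq_bot.2 ha)
  have h2 : (a : 𝔽 →ₗ[ℝ] 𝔽) ∘ (EuclideanSpace.basisFun (Fin n) ℝ).toBasis = familyOfOp a := by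
    funext i
    simp [familyOfOp]
  rwa [h2] at h

theorem injective_opOfFamily {f : Fin n → 𝔽} (hf : LinearIndependent ℝ f) :
    Function.Injective (opOfFamily f) := by
  refine (injective_iff_map_eq_zero _).2 fun v hv => ?_
  rw [opOfFamily_apply] at hv
  ext i
  exact Fintype.linearIndependent_iff.1 hf v hv i

/-- Nonzero orthogonal vectors, `n` in number, span `ℝⁿ`; Gram-Schmidt preserves the span, and `n`
spanning vectors are independent. -/
theorem linearIndependent_of_gramSchmidt_ne_zero {f : Fin n → 𝔽}
    (hf : ∀ i, gramSchmidt ℝ f i ≠ 0) : LinearIndependent ℝ f := by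
  have h1 : LinearIndependent ℝ (gramSchmidt ℝ f) :=
    linearIndependent_of_ne_zero_of_inner_eq_zero hf (gramSchmidt_pairwise_orthogonal ℝ f)
  have h2 := h1.span_eq_top_of_card_eq_finrank' (by simp)
  rw [span_gramSchmidt] at h2
  exact linearIndependent_of_top_le_span_of_card_eq_finrank h2.ge (by simp)

/-- The orthogonal part of an invertible operator, in the QR decomposition. -/
def orthPart (a : EuclideanSpace ℝ (Fin n) →L[ℝ] EuclideanSpace ℝ (Fin n)) :
    EuclideanSpace ℝ (Fin n) →L[ℝ] EuclideanSpace ℝ (Fin n) :=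
  opOfFamily (gramSchmidtNormed ℝ (familyOfOp a))

theorem norm_opOfFamily {f : Fin n → 𝔽} (hf : Orthonormal ℝ f) (v : 𝔽) :
    ‖opOfFamily f v‖ = ‖v‖ := by
  have h := hf.inner_sum (fun i => v i) (fun i => v i) Finset.univ
  rw [← opOfFamily_apply, real_inner_self_eq_norm_sq] at h
  have h2 : ‖opOfFamily f v‖ ^ 2 = ‖v‖ ^ 2 := by
    rw [h, EuclideanSpace.norm_sq_eq]
    simp [sq]
  exact (sq_eq_sq₀ (norm_nonneg _) (norm_nonneg _)).1 h2

theorem norm_orthPart {a : 𝔽 →L[ℝ] 𝔽} (ha : Function.Injective a) (v : 𝔽) :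
    ‖orthPart a v‖ = ‖v‖ :=
  norm_opOfFamily (gramSchmidtNormed_orthonormal (linearIndependent_familyOfOp ha)) v

theorem orthPart_of_isometry {a : 𝔽 →L[ℝ] 𝔽} (ha : ∀ v, ‖a v‖ = ‖v‖) : orthPart a = a := by
  have h : Orthonormal ℝ (familyOfOp a) := by
    have := (EuclideanSpace.basisFun (Fin n) ℝ).orthonormal.comp_linearIsometry
      (⟨a, ha⟩ : 𝔽 →ₗᵢ[ℝ] 𝔽)
    convert this using 1
    funext i
    simp [familyOfOp]
  have h1 : gramSchmidt ℝ (familyOfOp a) = familyOfOp a :=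
    gramSchmidt_of_orthogonal ℝ h.2
  have h2 : gramSchmidtNormed ℝ (familyOfOp a) = familyOfOp a := by
    funext i
    change (‖gramSchmidt ℝ (familyOfOp a) i‖⁻¹ : ℝ) • gramSchmidt ℝ (familyOfOp a) i = _
    rw [h1, h.1 i, inv_one, one_smul]
  rw [orthPart, h2, opOfFamily_familyOfOp]

theorem familyOfOp_path (a : 𝔽 →L[ℝ] 𝔽) (t : ℝ) :
    familyOfOp ((1 - t) • orthPart a + t • a) = fun i =>
      (1 - t) • gramSchmidtNormed ℝ (familyOfOp a) i + t • familyOfOp a i := by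
  funext i
  change (1 - t) • orthPart a (EuclideanSpace.single i 1) + t • a (EuclideanSpace.single i 1) = _
  rw [orthPart, opOfFamily_single]
  rfl

/-- The segment from an invertible operator to its orthogonal part never meets a singular operator,
since the Gram-Schmidt vectors of its columns stay nonzero. -/
theorem injective_orthPart_path {a : 𝔽 →L[ℝ] 𝔽} (ha : Function.Injective a) {t : ℝ}
    (ht0 : 0 ≤ t) (ht1 : t ≤ 1) : Function.Injective ((1 - t) • orthPart a + t • a) := by
  rw [← opOfFamily_familyOfOp ((1 - t) • orthPart a + t • a), familyOfOp_path]
  exact injective_opOfFamily (linearIndependent_of_gramSchmidt_ne_zero fun i =>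
    (gramSchmidtNormed_path (linearIndependent_familyOfOp ha) ht0 ht1 i).1)

theorem orthPart_path {a : 𝔽 →L[ℝ] 𝔽} (ha : Function.Injective a) {t : ℝ}
    (ht0 : 0 ≤ t) (ht1 : t ≤ 1) : orthPart ((1 - t) • orthPart a + t • a) = orthPart a := by
  rw [orthPart, familyOfOp_path]
  exact congrArg opOfFamily (funext fun i =>
    (gramSchmidtNormed_path (linearIndependent_familyOfOp ha) ht0 ht1 i).2)

theorem continuous_opOfFamily : Continuous (opOfFamily : (Fin n → 𝔽) → 𝔽 →L[ℝ] 𝔽) := by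
  refine continuous_finsetSum _ fun i _ => ?_
  exact (ContinuousLinearMap.smulRightL ℝ 𝔽 𝔽 _).continuous.comp (continuous_apply i)

theorem continuous_orthPart {X : Type*} [TopologicalSpace X] {f : X → 𝔽 →L[ℝ] 𝔽}
    (hf : Continuous f) (hinj : ∀ x, Function.Injective (f x)) :
    Continuous fun x => orthPart (f x) := by
  refine continuous_opOfFamily.comp (continuous_pi fun i => continuous_iff_continuousAt.2 fun x => ?_)
  have hx := linearIndependent_familyOfOp (hinj x)
  have h := continuousAt_gramSchmidt (f := fun y => familyOfOp (f y)) (x := x)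
    (fun j => (hf.clm_apply continuous_const).continuousAt) hx i
  exact ((h.norm).inv₀ (norm_ne_zero_iff.2 (gramSchmidt_ne_zero i hx))).smul h

end OrthogonalPart

/-! ### Operators preserving the positive cone of an indefinite form -/

section Cone

open Topology unitInterval

variable {n : ℕ} {W : Type*} [NormedAddCommGroup W] [NormedSpace ℝ W]
local notation "𝔽" => EuclideanSpace ℝ (Fin n)

variable (n W) in
/-- The monoid of operators on `ℝⁿ × W` that preserve the open cone of positive vectors of the form
`‖v‖² - ‖w‖²`. -/
def coneMonoid : Submonoid ((EuclideanSpace ℝ (Fin n) × W) →L[ℝ] (EuclideanSpace ℝ (Fin n) × W)) where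
  carrier := {m | ∀ u, ‖u.2‖ < ‖u.1‖ → ‖(m u).2‖ < ‖(m u).1‖}
  one_mem' := fun _ hu => hu
  mul_mem' := fun ha hb u hu => ha _ (hb u hu)

local notation "𝕊" => coneMonoid n W

/-- The upper left block of an operator on `ℝⁿ × W`. -/
def corner (m : (EuclideanSpace ℝ (Fin n) × W) →L[ℝ] (EuclideanSpace ℝ (Fin n) × W)) :
    EuclideanSpace ℝ (Fin n) →L[ℝ] EuclideanSpace ℝ (Fin n) :=
  (ContinuousLinearMap.fst ℝ 𝔽 W).comp (m.comp (ContinuousLinearMap.inl ℝ 𝔽 W))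

theorem corner_apply (m : (𝔽 × W) →L[ℝ] (𝔽 × W)) (v : 𝔽) : corner m v = (m (v, 0)).1 := rfl

theorem continuous_corner : Continuous (corner : ((𝔽 × W) →L[ℝ] (𝔽 × W)) → 𝔽 →L[ℝ] 𝔽) :=
  continuous_const.clm_comp (continuous_id.clm_comp continuous_const)

/-- For `v ≠ 0` the vector `(v, 0)` lies in the open cone, so its image does too and has a nonzero
first component. -/
theorem injective_corner (m : 𝕊) : Function.Injective (corner m.1) := by
  refine (injective_iff_map_eq_zero _).2 fun v hv => ?_
  by_contra h
  have := m.2 (v, 0) (by simpa using h)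
  rw [← corner_apply, hv, norm_zero] at this
  exact absurd this (norm_nonneg _).not_gt

/-- The orthogonal part of the upper left block. -/
def rot (m : coneMonoid n W) : EuclideanSpace ℝ (Fin n) →L[ℝ] EuclideanSpace ℝ (Fin n) :=
  orthPart (corner m.1)

theorem norm_rot (m : 𝕊) (v : 𝔽) : ‖rot m v‖ = ‖v‖ := norm_orthPart (injective_corner m) v

theorem continuous_rot : Continuous (rot : 𝕊 → 𝔽 →L[ℝ] 𝔽) :=
  continuous_orthPart (continuous_corner.comp continuous_subtype_val) injective_corner

/-- The first parameter of the deformation. -/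
def par₁ (t : I) : ℝ := min 1 (2 * (t : ℝ))

/-- The second parameter of the deformation. -/
def par₂ (t : I) : ℝ := max 0 (2 * (t : ℝ) - 1)

theorem par₁_nonneg (t : I) : 0 ≤ par₁ t := le_min zero_le_one (mul_nonneg zero_le_two t.2.1)
theorem par₁_le_one (t : I) : par₁ t ≤ 1 := min_le_left _ _
theorem par₂_nonneg (t : I) : 0 ≤ par₂ t := le_max_left _ _
theorem par₂_le_one (t : I) : par₂ t ≤ 1 := max_le zero_le_one (by linarith [t.2.2])
theorem par₁_zero : par₁ 0 = 0 := by simp [par₁]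
theorem par₁_one : par₁ 1 = 1 := by norm_num [par₁]
theorem par₂_zero : par₂ 0 = 0 := by simp [par₂]
theorem par₂_one : par₂ 1 = 1 := by norm_num [par₂]

/-- The deformation has two phases. Going down from `t = 1` to `1/2`, the blocks other than the
corner are scaled to zero with the corner fixed; from `1/2` to `0`, the corner moves to its
orthogonal part. Separating the phases is what keeps the operators in the cone monoid. -/
theorem par₁_eq_one_or_par₂_eq_zero (t : I) : par₁ t = 1 ∨ par₂ t = 0 := by
  rcases le_total 1 (2 * (t : ℝ)) with h | h
  · exact Or.inl (min_eq_left h)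
  · exact Or.inr (max_eq_left (by linarith))

theorem continuous_par₁ : Continuous par₁ := by unfold par₁; fun_prop
theorem continuous_par₂ : Continuous par₂ := by unfold par₂; fun_prop

/-- The deformation of the cone monoid onto the orthogonal group of `ℝⁿ`, on operators. -/
def scaleOp (t : I) (m : (EuclideanSpace ℝ (Fin n) × W) →L[ℝ] (EuclideanSpace ℝ (Fin n) × W)) :
    (EuclideanSpace ℝ (Fin n) × W) →L[ℝ] (EuclideanSpace ℝ (Fin n) × W) :=
  (ContinuousLinearMap.inl ℝ 𝔽 W).comp
      (((1 - par₁ t) • orthPart (corner m) + par₁ t • corner m).comp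
        (ContinuousLinearMap.fst ℝ 𝔽 W))
    + par₂ t • ((ContinuousLinearMap.inl ℝ 𝔽 W).comp (ContinuousLinearMap.fst ℝ 𝔽 W)).comp
      (m.comp ((ContinuousLinearMap.inr ℝ 𝔽 W).comp (ContinuousLinearMap.snd ℝ 𝔽 W)))
    + par₂ t • ((ContinuousLinearMap.inr ℝ 𝔽 W).comp (ContinuousLinearMap.snd ℝ 𝔽 W)).comp
      (m.comp ((ContinuousLinearMap.inl ℝ 𝔽 W).comp (ContinuousLinearMap.fst ℝ 𝔽 W)
        + par₂ t • (ContinuousLinearMap.inr ℝ 𝔽 W).comp (ContinuousLinearMap.snd ℝ 𝔽 W)))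

theorem scaleOp_apply (t : I) (m : (𝔽 × W) →L[ℝ] (𝔽 × W)) (v : 𝔽) (w : W) :
    scaleOp t m (v, w) = (((1 - par₁ t) • orthPart (corner m) v + par₁ t • corner m v)
      + par₂ t • (m (0, w)).1, par₂ t • (m (v, par₂ t • w)).2) := by
  have e : m (v, par₂ t • w) = m (v, 0) + par₂ t • m (0, w) := by
    rw [← map_smul, ← map_add]
    simp
  rw [e]
  simp [scaleOp]

theorem corner_scaleOp (t : I) (m : (𝔽 × W) →L[ℝ] (𝔽 × W)) :
    corner (scaleOp t m) = (1 - par₁ t) • orthPart (corner m) + par₁ t • corner m := by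
  ext1 v
  rw [corner_apply, scaleOp_apply]
  simp [← Prod.zero_eq_mk]

/-- With `s = par₂ t`, in the phase `par₁ t = 1` the operator is `m` composed on both sides with
`(v, w) ↦ (v, s • w)`, which preserves the cone as `0 ≤ s ≤ 1`. In the phase `s = 0` the second
component vanishes, and injectivity of the deformed corner suffices. -/
theorem scaleOp_mem (t : I) (m : 𝕊) : scaleOp t m.1 ∈ 𝕊 := by
  rintro ⟨v, w⟩ h
  dsimp only at h
  have hv : v ≠ 0 := fun h0 => by
    rw [h0, norm_zero] at h
    exact absurd h (norm_nonneg _).not_gt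
  rw [scaleOp_apply]
  rcases par₁_eq_one_or_par₂_eq_zero t with h1 | h2
  · rw [h1]
    have hw : ‖par₂ t • w‖ < ‖v‖ := by
      refine lt_of_le_of_lt ?_ h
      rw [norm_smul, Real.norm_of_nonneg (par₂_nonneg t)]
      exact mul_le_of_le_one_left (norm_nonneg _) (par₂_le_one t)
    have hm := m.2 (v, par₂ t • w) hw
    have e : m.1 (v, par₂ t • w) = m.1 (v, 0) + par₂ t • m.1 (0, w) := by
      rw [← map_smul, ← map_add]
      simp
    have e1 : ((1 - (1 : ℝ)) • orthPart (corner m.1) v + (1 : ℝ) • corner m.1 v)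
        + par₂ t • (m.1 (0, w)).1 = (m.1 (v, par₂ t • w)).1 := by
      rw [e, sub_self, zero_smul, zero_add, one_smul]
      rfl
    rw [e1]
    refine lt_of_le_of_lt ?_ hm
    rw [norm_smul, Real.norm_of_nonneg (par₂_nonneg t)]
    exact mul_le_of_le_one_left (norm_nonneg _) (par₂_le_one t)
  · have := (injective_iff_map_eq_zero _).1 (injective_orthPart_path (injective_corner m)
      (par₁_nonneg t) (par₁_le_one t)) v
    simp only [h2, zero_smul, norm_zero, add_zero, norm_pos_iff]
    exact fun h => hv (this h)

/-- The deformation of the cone monoid onto the orthogonal group of `ℝⁿ`. -/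
def scale (t : I) (m : coneMonoid n W) : coneMonoid n W := ⟨scaleOp t m.1, scaleOp_mem t m⟩

/-- Because of this invariance the deformation lifts to the covering with constant pin component. -/
theorem rot_scale (t : I) (m : 𝕊) : rot (scale t m) = rot m := by
  rw [rot, scale, corner_scaleOp, orthPart_path (injective_corner m) (par₁_nonneg t) (par₁_le_one t)]
  rfl

theorem scale_one (m : 𝕊) : scale 1 m = m := by
  refine Subtype.ext (ContinuousLinearMap.ext fun ⟨v, w⟩ => ?_)
  change scaleOp 1 m.1 (v, w) = _
  have e : m.1 (v, w) = m.1 (v, 0) + m.1 (0, w) := by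
    rw [← map_add]
    simp
  rw [scaleOp_apply, par₁_one, par₂_one, one_smul, one_smul, sub_self, zero_smul, one_smul, one_smul,
    zero_add]
  refine Prod.ext ?_ rfl
  rw [e]
  rfl

theorem continuous_scale_comp {X : Type*} [TopologicalSpace X] {f : X → I} {g : X → 𝕊}
    (hf : Continuous f) (hg : Continuous g) : Continuous fun x => scale (f x) (g x) := by
  refine Continuous.subtype_mk ?_ _
  have h1 : Continuous fun x => par₁ (f x) := continuous_par₁.comp hf
  have h2 : Continuous fun x => par₂ (f x) := continuous_par₂.comp hf
  have hm : Continuous fun x => (g x).1 := continuous_subtype_val.comp hg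
  have hr : Continuous fun x => orthPart (corner (g x).1) := continuous_rot.comp hg
  have hc : Continuous fun x => corner (g x).1 := continuous_corner.comp hm
  exact ((continuous_const.clm_comp ((((continuous_const.sub h1).smul hr).add
      (h1.smul hc)).clm_comp continuous_const)).add
    (h2.smul (continuous_const.clm_comp (hm.clm_comp continuous_const)))).add
    (h2.smul (continuous_const.clm_comp (hm.clm_comp
      (continuous_const.add (h2.smul continuous_const)))))

/-- Block diagonal operators with isometric upper left block. -/
structure IsBlockIsometry (m : coneMonoid n W) : Prop where
  norm_corner : ∀ v, ‖corner m.1 v‖ = ‖v‖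
  snd_apply : ∀ v, (m.1 (v, 0)).2 = 0
  fst_apply : ∀ w, (m.1 (0, w)).1 = 0

theorem IsBlockIsometry.rot_eq {m : 𝕊} (hm : IsBlockIsometry m) : rot m = corner m.1 :=
  orthPart_of_isometry hm.norm_corner

theorem IsBlockIsometry.one : IsBlockIsometry (1 : 𝕊) := ⟨fun _ => rfl, fun _ => rfl, fun _ => rfl⟩

/-- The left factor sends `0 × W` into itself, so the second component of `k (v, 0)` does not return
to `ℝⁿ`. Together with `rot_eq` this makes `rot` multiplicative on block isometries. -/
theorem IsBlockIsometry.corner_mul {m : 𝕊} (k : 𝕊) (hm : IsBlockIsometry m) :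
    corner (m * k).1 = corner m.1 * corner k.1 := by
  ext1 v
  change (m.1 (k.1 (v, 0))).1 = (m.1 ((k.1 (v, 0)).1, 0)).1
  have e : m.1 (k.1 (v, 0)) = m.1 ((k.1 (v, 0)).1, 0) + m.1 (0, (k.1 (v, 0)).2) := by
    rw [← map_add]
    simp
  rw [e, Prod.fst_add, hm.fst_apply, add_zero]

theorem IsBlockIsometry.mul {m k : 𝕊} (hm : IsBlockIsometry m) (hk : IsBlockIsometry k) :
    IsBlockIsometry (m * k) where
  norm_corner v := by
    rw [hm.corner_mul]
    exact (hm.norm_corner _).trans (hk.norm_corner v)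
  snd_apply v := by
    change (m.1 (k.1 (v, 0))).2 = 0
    have e : k.1 (v, 0) = ((k.1 (v, 0)).1, 0) := Prod.ext rfl (hk.snd_apply v)
    rw [e, hm.snd_apply]
  fst_apply w := by
    change (m.1 (k.1 (0, w))).1 = 0
    have e : k.1 (0, w) = (0, (k.1 (0, w)).2) := Prod.ext (hk.fst_apply w) rfl
    rw [e, hm.fst_apply]

theorem IsBlockIsometry.corner_scale {m : 𝕊} (hm : IsBlockIsometry m) (t : I) :
    corner (scale t m).1 = corner m.1 := by
  ext1 v
  rw [scale, corner_scaleOp, orthPart_of_isometry hm.norm_corner]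
  change (1 - par₁ t) • corner m.1 v + par₁ t • corner m.1 v = _
  rw [← add_smul, sub_add_cancel, one_smul]

theorem IsBlockIsometry.scale {m : 𝕊} (hm : IsBlockIsometry m) (t : I) :
    IsBlockIsometry (scale t m) where
  norm_corner v := by rw [hm.corner_scale, hm.norm_corner]
  snd_apply v := by
    change (scaleOp t m.1 (v, 0)).2 = 0
    rw [scaleOp_apply, smul_zero, hm.snd_apply, smul_zero]
  fst_apply w := by
    change (scaleOp t m.1 (0, w)).1 = 0
    simp only [scaleOp_apply, map_zero, hm.fst_apply, smul_zero, add_zero]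

theorem isBlockIsometry_scale_zero (m : 𝕊) : IsBlockIsometry (scale 0 m) where
  norm_corner v := by
    rw [scale, corner_scaleOp, par₁_zero]
    change ‖(1 - (0 : ℝ)) • orthPart (corner m.1) v + (0 : ℝ) • corner m.1 v‖ = _
    rw [sub_zero, one_smul, zero_smul, add_zero]
    exact norm_rot m v
  snd_apply v := by
    change (scaleOp 0 m.1 (v, 0)).2 = 0
    simp only [scaleOp_apply, par₂_zero, zero_smul]
  fst_apply w := by
    change (scaleOp 0 m.1 (0, w)).1 = 0
    simp only [scaleOp_apply, par₂_zero, zero_smul, map_zero, smul_zero, add_zero]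

end Cone

/-! ### The double covering of the cone monoid -/

section ConeCover

open Topology unitInterval

variable {n : ℕ} {V : Type*} [AddCommGroup V] [Module ℂ V] {q : QuadraticForm ℂ V}
  {E : Module.Basis (Fin n) ℂ V}

/-- The double covering of the cone monoid defined by the pin group. -/
def ConeCover (_ : IsOrthonormalFor q E) (W : Type*) [NormedAddCommGroup W] [NormedSpace ℝ W] :
    Type _ :=
  pinCover E q (rot : coneMonoid n W → _)

set_option linter.unusedSectionVars false

variable (hE : IsOrthonormalFor q E) (W : Type*) [NormedAddCommGroup W] [NormedSpace ℝ W]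

instance : TopologicalSpace (ConeCover hE W) := inferInstanceAs (TopologicalSpace (pinCover E q _))

variable {hE W}

namespace ConeCover

/-- The covering projection. -/
def proj (x : ConeCover hE W) : coneMonoid n W := x.1.1

/-- The pin component. -/
def pin (x : ConeCover hE W) : Cl q := x.1.2

theorem ext {x y : ConeCover hE W} (h1 : x.proj = y.proj) (h2 : x.pin = y.pin) : x = y :=
  Subtype.ext (Prod.ext h1 h2)

theorem continuous_proj : Continuous (proj : ConeCover hE W → _) :=
  continuous_fst.comp continuous_subtype_val

theorem continuous_pin : Continuous (pin : ConeCover hE W → _) :=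
  continuous_snd.comp continuous_subtype_val

theorem mem (x : ConeCover hE W) : (rot x.proj, x.pin) ∈ pinPairs q E := x.2

variable (hE) in
/-- The element with given components. -/
def mk (m : coneMonoid n W) (c : Cl q) (h : (rot m, c) ∈ pinPairs q E) : ConeCover hE W :=
  ⟨(m, c), h⟩

theorem continuous_mk {X : Type*} [TopologicalSpace X] {m : X → coneMonoid n W} {c : X → Cl q}
    (hm : Continuous m) (hc : Continuous c) (h : ∀ x, (rot (m x), c x) ∈ pinPairs q E) :
    Continuous fun x => mk hE (m x) (c x) (h x) :=
  (hm.prodMk hc).subtype_mk _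

/-- The lift of the deformation of the cone monoid. -/
def scale (t : I) (x : ConeCover hE W) : ConeCover hE W :=
  mk hE (DoubleCover.scale t x.proj) x.pin (by rw [rot_scale]; exact x.mem)

theorem scale_one (x : ConeCover hE W) : scale 1 x = x := ext (DoubleCover.scale_one _) rfl

theorem mul_mem_of_block {x y : ConeCover hE W} {m k : coneMonoid n W} (hm : IsBlockIsometry m)
    (hk : IsBlockIsometry k) (hx : rot m = rot x.proj) (hy : rot k = rot y.proj) :
    (rot (m * k), x.pin * y.pin) ∈ pinPairs q E := by
  rw [(hm.mul hk).rot_eq, hm.corner_mul, ← hm.rot_eq, ← hk.rot_eq, hx, hy]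
  exact mk_mul_mem_pinPairs x.mem y.mem

theorem isCoveringMap_proj [FiniteDimensional ℂ V] [NeZero n] :
    IsCoveringMap (proj : ConeCover hE W → _) :=
  isCoveringMap_pinCover hE continuous_rot norm_rot

/-- Uniqueness of path lifting. Each algebraic law of the covering monoid is reduced by it to `t =
0`, where pin components multiply in the Clifford algebra. -/
theorem eq_one_of_path [FiniteDimensional ℂ V] [NeZero n] {Γ Γ' : I → ConeCover hE W}
    (h : Continuous Γ) (h' : Continuous Γ') (hp : ∀ t, (Γ t).proj = (Γ' t).proj)
    (h0 : Γ 0 = Γ' 0) : Γ 1 = Γ' 1 :=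
  congrFun (isCoveringMap_proj.eq_of_comp_eq h h' (funext hp) 0 h0) 1

section Mul

variable [FiniteDimensional ℂ V] [NeZero n]

/-- The homotopy of products in the cone monoid. -/
def mulHomotopy : C(I × (ConeCover hE W × ConeCover hE W), coneMonoid n W) where
  toFun p := DoubleCover.scale p.1 p.2.1.proj * DoubleCover.scale p.1 p.2.2.proj
  continuous_toFun :=
    (continuous_scale_comp continuous_fst (continuous_proj.comp (continuous_fst.comp continuous_snd))).mul
    (continuous_scale_comp continuous_fst (continuous_proj.comp (continuous_snd.comp continuous_snd)))

/-- The initial value of the lift of the homotopy of products. -/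
def mulStart : C(ConeCover hE W × ConeCover hE W, ConeCover hE W) where
  toFun p := mk hE (DoubleCover.scale 0 p.1.proj * DoubleCover.scale 0 p.2.proj) (p.1.pin * p.2.pin)
    (mul_mem_of_block (isBlockIsometry_scale_zero _) (isBlockIsometry_scale_zero _) (rot_scale _ _)
      (rot_scale _ _))
  continuous_toFun := continuous_mk
    ((continuous_scale_comp continuous_const (continuous_proj.comp continuous_fst)).mul
    (continuous_scale_comp continuous_const (continuous_proj.comp continuous_snd)))
    ((continuous_pin.comp continuous_fst).mul (continuous_pin.comp continuous_snd)) _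

/-- The lift of the homotopy of products. -/
def mulLift : C(I × (ConeCover hE W × ConeCover hE W), ConeCover hE W) :=
  isCoveringMap_proj.liftHomotopy mulHomotopy mulStart fun _ => rfl

/-- The multiplication of the double covering of the cone monoid. -/
instance : Mul (ConeCover hE W) := ⟨fun x y => mulLift (1, (x, y))⟩

theorem proj_mulLift (t : I) (x y : ConeCover hE W) :
    (mulLift (t, (x, y))).proj = DoubleCover.scale t x.proj * DoubleCover.scale t y.proj :=
  congrFun (isCoveringMap_proj.liftHomotopy_lifts mulHomotopy (mulStart (hE := hE) (W := W))
    fun _ => rfl) (t, (x, y))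

theorem proj_mul (x y : ConeCover hE W) : (x * y).proj = x.proj * y.proj := by
  refine (proj_mulLift 1 x y).trans ?_
  rw [DoubleCover.scale_one, DoubleCover.scale_one]

instance : ContinuousMul (ConeCover hE W) :=
  ⟨mulLift.continuous.comp (Continuous.prodMk_right 1)⟩

/-- For block isometries the path with constant pin component `x.pin * y.pin` lies over the homotopy
of products and has the right start, so it is the lift that defines the product. -/
theorem pin_mul_of_block {x y : ConeCover hE W} (hx : IsBlockIsometry x.proj)
    (hy : IsBlockIsometry y.proj) : (x * y).pin = x.pin * y.pin := by
  let Γ : I → ConeCover hE W := fun t => mk hE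
    (DoubleCover.scale t x.proj * DoubleCover.scale t y.proj) (x.pin * y.pin)
    (mul_mem_of_block (hx.scale t) (hy.scale t) (rot_scale _ _) (rot_scale _ _))
  have hΓ : Continuous Γ := continuous_mk
    ((continuous_scale_comp continuous_id continuous_const).mul
    (continuous_scale_comp continuous_id continuous_const)) continuous_const _
  have h := eq_one_of_path (Γ := fun t => mulLift (t, (x, y)))
    (mulLift.continuous.comp (Continuous.prodMk_left _)) hΓ (fun t => proj_mulLift t x y)
    (isCoveringMap_proj.liftHomotopy_zero mulHomotopy mulStart (fun _ => rfl) (x, y))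
  exact congrArg pin h

theorem continuous_scale_left (x : ConeCover hE W) : Continuous fun t => scale t x :=
  continuous_mk (continuous_scale_comp continuous_id continuous_const) continuous_const _

theorem isBlockIsometry_proj_scale (x : ConeCover hE W) : IsBlockIsometry (scale 0 x).proj :=
  isBlockIsometry_scale_zero _

theorem isBlockIsometry_proj_mul {x y : ConeCover hE W} (hx : IsBlockIsometry x.proj)
    (hy : IsBlockIsometry y.proj) : IsBlockIsometry (x * y).proj := by
  rw [proj_mul]
  exact hx.mul hy

instance : One (ConeCover hE W) :=
  ⟨mk hE 1 1 (by rw [IsBlockIsometry.one.rot_eq]; exact one_mem (pinPairs q E))⟩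

theorem proj_one : (1 : ConeCover hE W).proj = 1 := rfl

theorem pin_one : (1 : ConeCover hE W).pin = 1 := rfl

theorem isBlockIsometry_proj_one : IsBlockIsometry (1 : ConeCover hE W).proj := IsBlockIsometry.one

instance : Monoid (ConeCover hE W) where
  mul_assoc x y z := by
    -- Both bracketings give paths over the same path of triple products; at `t = 0` they agree by
    -- associativity of the Clifford algebra.
    have h := eq_one_of_path (Γ := fun t => scale t x * scale t y * scale t z)
      (Γ' := fun t => scale t x * (scale t y * scale t z))
      (((continuous_scale_left x).mul (continuous_scale_left y)).mul (continuous_scale_left z))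
      ((continuous_scale_left x).mul ((continuous_scale_left y).mul (continuous_scale_left z)))
      (fun t => by simp only [proj_mul, mul_assoc]) ?_
    · simpa only [scale_one] using h
    · have hx := isBlockIsometry_proj_scale x
      have hy := isBlockIsometry_proj_scale y
      have hz := isBlockIsometry_proj_scale z
      refine ext (by simp only [proj_mul, mul_assoc]) ?_
      rw [pin_mul_of_block (isBlockIsometry_proj_mul hx hy) hz, pin_mul_of_block hx hy,
        pin_mul_of_block hx (isBlockIsometry_proj_mul hy hz), pin_mul_of_block hy hz, mul_assoc]
  one_mul x := by
    have h := eq_one_of_path (Γ := fun t => 1 * scale t x) (Γ' := fun t => scale t x)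
      (continuous_const.mul (continuous_scale_left x)) (continuous_scale_left x)
      (fun t => by rw [proj_mul, proj_one, one_mul]) ?_
    · simpa only [scale_one] using h
    · refine ext (by rw [proj_mul, proj_one, one_mul]) ?_
      rw [pin_mul_of_block isBlockIsometry_proj_one (isBlockIsometry_proj_scale x), pin_one, one_mul]
  mul_one x := by
    have h := eq_one_of_path (Γ := fun t => scale t x * 1) (Γ' := fun t => scale t x)
      ((continuous_scale_left x).mul continuous_const) (continuous_scale_left x)
      (fun t => by rw [proj_mul, proj_one, mul_one]) ?_
    · simpa only [scale_one] using h
    · refine ext (by rw [proj_mul, proj_one, mul_one]) ?_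
      rw [pin_mul_of_block (isBlockIsometry_proj_scale x) isBlockIsometry_proj_one, pin_one, mul_one]

/-- The deck transformation. -/
instance : Neg (ConeCover hE W) := ⟨fun x => mk hE x.proj (-x.pin) (neg_mem_pinPairs hE x.mem)⟩

theorem proj_neg (x : ConeCover hE W) : (-x).proj = x.proj := rfl

theorem pin_neg (x : ConeCover hE W) : (-x).pin = -x.pin := rfl

instance : ContinuousNeg (ConeCover hE W) := ⟨continuous_mk continuous_proj continuous_pin.neg _⟩

instance : HasDistribNeg (ConeCover hE W) where
  neg_neg x := ext rfl (neg_neg x.pin)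
  neg_mul x y := by
    have h := eq_one_of_path (Γ := fun t => -scale t x * scale t y)
      (Γ' := fun t => -(scale t x * scale t y))
      ((continuous_scale_left x).neg.mul (continuous_scale_left y))
      ((continuous_scale_left x).mul (continuous_scale_left y)).neg
      (fun t => by simp only [proj_mul, proj_neg]) ?_
    · simpa only [scale_one] using h
    · have hx := isBlockIsometry_proj_scale x
      have hy := isBlockIsometry_proj_scale y
      refine ext (by simp only [proj_mul, proj_neg]) ?_
      rw [pin_mul_of_block (x := -scale 0 x) hx hy, pin_neg, pin_neg, pin_mul_of_block hx hy,
        neg_mul]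
  mul_neg x y := by
    have h := eq_one_of_path (Γ := fun t => scale t x * -scale t y)
      (Γ' := fun t => -(scale t x * scale t y))
      ((continuous_scale_left x).mul (continuous_scale_left y).neg)
      ((continuous_scale_left x).mul (continuous_scale_left y)).neg
      (fun t => by simp only [proj_mul, proj_neg]) ?_
    · simpa only [scale_one] using h
    · have hx := isBlockIsometry_proj_scale x
      have hy := isBlockIsometry_proj_scale y
      refine ext (by simp only [proj_mul, proj_neg]) ?_
      rw [pin_mul_of_block (y := -scale 0 y) hx hy, pin_neg, pin_neg, pin_mul_of_block hx hy,
        mul_neg]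

end Mul

end ConeCover

end ConeCover

/-! ### The double covering of a group acting on `ℝⁿ × W` -/

section PinExt

variable {n : ℕ} {V : Type*} [AddCommGroup V] [Module ℂ V] {q : QuadraticForm ℂ V}
  {E : Module.Basis (Fin n) ℂ V} {W : Type*} [NormedAddCommGroup W] [NormedSpace ℝ W]
  {G : Type*} [Group G]

set_option linter.unusedSectionVars false

/-- The pullback of the double covering of the cone monoid along a homomorphism from a group. -/
def PinExt (_ : IsOrthonormalFor q E) (ρ : G →* coneMonoid n W) : Type _ :=
  pinCover E q fun g => rot (ρ g)

variable {hE : IsOrthonormalFor q E} {ρ : G →* coneMonoid n W}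

namespace PinExt

/-- The underlying element of the group. -/
def base (x : PinExt hE ρ) : G := x.1.1

/-- The pin component. -/
def pin (x : PinExt hE ρ) : Cl q := x.1.2

theorem mem (x : PinExt hE ρ) : (rot (ρ x.base), x.pin) ∈ pinPairs q E := x.2

/-- The element with given components. -/
def mk (g : G) (c : Cl q) (h : (rot (ρ g), c) ∈ pinPairs q E) : PinExt hE ρ := ⟨(g, c), h⟩

theorem ext {x y : PinExt hE ρ} (h1 : x.base = y.base) (h2 : x.pin = y.pin) : x = y :=
  Subtype.ext (Prod.ext h1 h2)

/-- The map to the double covering of the cone monoid. -/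
def toCone (x : PinExt hE ρ) : ConeCover hE W := ConeCover.mk hE (ρ x.base) x.pin x.mem

theorem ext_toCone {x y : PinExt hE ρ} (h1 : x.base = y.base) (h2 : x.toCone = y.toCone) : x = y :=
  ext h1 (congrArg ConeCover.pin h2)

variable [FiniteDimensional ℂ V] [NeZero n]

/-- The inverse image of an element of the group, in the double covering of the cone monoid. -/
def ofCone (g : G) (x : ConeCover hE W) (h : x.proj = ρ g) : PinExt hE ρ :=
  mk g x.pin (h ▸ x.mem)

theorem toCone_ofCone (g : G) (x : ConeCover hE W) (h : x.proj = ρ g) : (ofCone g x h).toCone = x :=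
  ConeCover.ext h.symm rfl

instance : Mul (PinExt hE ρ) :=
  ⟨fun x y => ofCone (x.base * y.base) (x.toCone * y.toCone) <| by
    rw [ConeCover.proj_mul]
    exact (ρ.map_mul _ _).symm⟩

instance : One (PinExt hE ρ) := ⟨ofCone 1 1 ρ.map_one.symm⟩

instance : Neg (PinExt hE ρ) := ⟨fun x => ofCone x.base (-x.toCone) rfl⟩

theorem base_mul (x y : PinExt hE ρ) : (x * y).base = x.base * y.base := rfl
theorem base_one : (1 : PinExt hE ρ).base = 1 := rfl
theorem pin_one : (1 : PinExt hE ρ).pin = 1 := rfl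
theorem toCone_mul (x y : PinExt hE ρ) : (x * y).toCone = x.toCone * y.toCone :=
  toCone_ofCone _ _ _
theorem toCone_one : (1 : PinExt hE ρ).toCone = 1 := toCone_ofCone _ _ _
theorem toCone_neg (x : PinExt hE ρ) : (-x).toCone = -x.toCone := toCone_ofCone _ _ _

theorem neg_mul' (x y : PinExt hE ρ) : -x * y = -(x * y) :=
  ext_toCone rfl (by rw [toCone_mul, toCone_neg, toCone_neg, toCone_mul, neg_mul])

theorem mul_neg' (x y : PinExt hE ρ) : x * -y = -(x * y) :=
  ext_toCone rfl (by rw [toCone_mul, toCone_neg, toCone_neg, toCone_mul, mul_neg])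

theorem neg_neg' (x : PinExt hE ρ) : - -x = x :=
  ext_toCone rfl (by rw [toCone_neg, toCone_neg, neg_neg])

theorem eq_or_eq_neg {x y : PinExt hE ρ} (h : y.base = x.base) : y = x ∨ y = -x := by
  have hy := y.mem
  rw [h] at hy
  exact (eq_or_eq_neg_of_mem_pinPairs hE x.mem hy).imp (ext h) (ext h)

theorem neg_ne (x : PinExt hE ρ) : -x ≠ x :=
  fun h => neg_ne_of_mem_pinPairs x.mem (congrArg pin h)

theorem surjective_base : Function.Surjective (base : PinExt hE ρ → G) := fun g => by
  obtain ⟨c, hc⟩ := exists_mem_pinPairs hE (norm_rot (ρ g))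
  exact ⟨mk g c hc, rfl⟩

/-- The cone monoid offers no inverses, so these come from `G`: any lift of the inverse gives a
product over `1`, that is `1` or `-1`, and a change of sign repairs the second case. -/
theorem exists_left_inv (x : PinExt hE ρ) : ∃ y : PinExt hE ρ, y * x = 1 := by
  obtain ⟨y, hy⟩ := surjective_base (hE := hE) (ρ := ρ) x.base⁻¹
  have h : (y * x).base = (1 : PinExt hE ρ).base := by
    rw [base_mul, hy, inv_mul_cancel, base_one]
  rcases eq_or_eq_neg h with h | h
  · exact ⟨y, h⟩
  · exact ⟨-y, by rw [neg_mul', h, neg_neg']⟩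

instance : Inv (PinExt hE ρ) := ⟨fun x => (exists_left_inv x).choose⟩

instance : Group (PinExt hE ρ) :=
  Group.ofLeftAxioms
    (fun x y z => ext_toCone (mul_assoc _ _ _) (by simp only [toCone_mul, mul_assoc]))
    (fun x => ext_toCone (one_mul _) (by rw [toCone_mul, toCone_one, one_mul]))
    (fun x => (exists_left_inv x).choose_spec)

variable (hE ρ) in
/-- The projection onto the group. -/
def proj : PinExt hE ρ →* G where
  toFun := base
  map_one' := rfl
  map_mul' _ _ := rfl

theorem mem_ker_proj {x : PinExt hE ρ} : x ∈ (proj hE ρ).ker ↔ x = 1 ∨ x = -1 := by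
  refine ⟨fun h => eq_or_eq_neg h, ?_⟩
  rintro (rfl | rfl) <;> exact rfl

theorem card_ker_proj : Nat.card (proj hE ρ).ker = 2 := by
  rw [Nat.card_eq_two_iff]
  refine ⟨⟨1, one_mem _⟩, ⟨-1, mem_ker_proj.2 (Or.inr rfl)⟩,
    fun h => neg_ne (1 : PinExt hE ρ) (congrArg Subtype.val h).symm, ?_⟩
  refine Set.eq_univ_of_forall fun x => ?_
  exact (mem_ker_proj.1 x.2).imp Subtype.ext Subtype.ext

theorem ker_proj_le_center : (proj hE ρ).ker ≤ Subgroup.center (PinExt hE ρ) := by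
  intro x hx
  rw [Subgroup.mem_center_iff]
  intro y
  rcases mem_ker_proj.1 hx with rfl | rfl
  · rw [one_mul, mul_one]
  · rw [mul_neg', neg_mul', mul_one, one_mul]

theorem pin_mul_of_block {x y : PinExt hE ρ} (hx : IsBlockIsometry (ρ x.base))
    (hy : IsBlockIsometry (ρ y.base)) : (x * y).pin = x.pin * y.pin :=
  ConeCover.pin_mul_of_block (x := x.toCone) (y := y.toCone) hx hy

section Topology

open Topology

variable [TopologicalSpace G]

instance : TopologicalSpace (PinExt hE ρ) := inferInstanceAs (TopologicalSpace (pinCover E q _))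

theorem continuous_base : Continuous (base : PinExt hE ρ → G) :=
  continuous_fst.comp continuous_subtype_val

theorem continuous_pin : Continuous (pin : PinExt hE ρ → Cl q) :=
  continuous_snd.comp continuous_subtype_val

theorem isCoveringMap_proj (hρ : Continuous ρ) : IsCoveringMap (proj hE ρ) :=
  isCoveringMap_pinCover hE (continuous_rot.comp hρ) fun g => norm_rot (ρ g)

theorem continuousMul [ContinuousMul G] (hρ : Continuous ρ) : ContinuousMul (PinExt hE ρ) := by
  have hc : Continuous (toCone : PinExt hE ρ → _) :=
    ConeCover.continuous_mk (hρ.comp continuous_base) continuous_pin _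
  refine ⟨Continuous.subtype_mk (Continuous.prodMk ?_ ?_) _⟩
  · exact (continuous_base.comp continuous_fst).mul (continuous_base.comp continuous_snd)
  · exact ConeCover.continuous_pin.comp ((hc.comp continuous_fst).mul (hc.comp continuous_snd))

end Topology

end PinExt

end PinExt

/-! ### Pulling back manifold and Lie group structures along local homeomorphisms -/

section Pullback

open Topology

variable {𝕜 F H M M' : Type*} [NontriviallyNormedField 𝕜] [NormedAddCommGroup F] [NormedSpace 𝕜 F]
  [TopologicalSpace H] {I : ModelWithCorners 𝕜 F H} [TopologicalSpace M] [ChartedSpace H M]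
  [TopologicalSpace M'] {p : M' → M}

/-- A local homeomorphism near a point, which coincides with the given map `p`. -/
def localHomeo (hp : IsLocalHomeomorph p) (x : M') : OpenPartialHomeomorph M' M := (hp x).choose

theorem mem_localHomeo_source (hp : IsLocalHomeomorph p) (x : M') : x ∈ (localHomeo hp x).source :=
  (hp x).choose_spec.1

theorem coe_localHomeo (hp : IsLocalHomeomorph p) (x : M') : ⇑(localHomeo hp x) = p :=
  (hp x).choose_spec.2.symm

theorem localHomeo_symm (hp : IsLocalHomeomorph p) (x : M') {y : M}
    (hy : y ∈ (localHomeo hp x).target) : p ((localHomeo hp x).symm y) = y := by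
  have := (localHomeo hp x).right_inv hy
  rwa [coe_localHomeo] at this

/-- The charts of the source of a local homeomorphism into a manifold. -/
@[reducible]
def pullbackChartedSpace (hp : IsLocalHomeomorph p) : ChartedSpace H M' where
  atlas := Set.range fun x => (localHomeo hp x).trans (chartAt H (p x))
  chartAt x := (localHomeo hp x).trans (chartAt H (p x))
  mem_chart_source x := by
    rw [OpenPartialHomeomorph.trans_source, Set.mem_inter_iff, Set.mem_preimage, coe_localHomeo]
    exact ⟨mem_localHomeo_source hp x, mem_chart_source H (p x)⟩
  chart_mem_atlas x := ⟨x, rfl⟩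

/-- Since `p` undoes its local inverses, the transition maps upstairs are restrictions to open sets
of transition maps of `M`. -/
theorem pullback_isManifold (hp : IsLocalHomeomorph p) (n : WithTop ℕ∞) [IsManifold I n M] :
    letI := pullbackChartedSpace (H := H) hp
    IsManifold I n M' := by
  let := pullbackChartedSpace (H := H) hp
  have : HasGroupoid M' (contDiffGroupoid n I) := by
    refine ⟨?_⟩
    rintro _ _ ⟨x, rfl⟩ ⟨y, rfl⟩
    set e := (localHomeo hp x).trans (chartAt H (p x)) with he
    set e' := (localHomeo hp y).trans (chartAt H (p y)) with he'
    have key : ∀ z ∈ (e.symm.trans e').source, (e.symm.trans e') z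
        = (chartAt H (p y)) ((chartAt H (p x)).symm z) ∧
        z ∈ ((chartAt H (p x)).symm.trans (chartAt H (p y))).source := by
      intro z hz
      simp only [he, he', OpenPartialHomeomorph.trans_source, OpenPartialHomeomorph.trans_symm_eq_symm_trans_symm,
        OpenPartialHomeomorph.coe_trans, OpenPartialHomeomorph.symm_source, Set.mem_inter_iff,
        Set.mem_preimage, Function.comp_apply, coe_localHomeo] at hz ⊢
      obtain ⟨⟨h1, h2⟩, h3, h4⟩ := hz
      rw [localHomeo_symm hp x h2] at h4 ⊢
      exact ⟨rfl, h1, h4⟩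
    have hmem : (chartAt H (p x)).symm.trans (chartAt H (p y)) ∈ contDiffGroupoid n I :=
      HasGroupoid.compatible (chart_mem_atlas H (p x)) (chart_mem_atlas H (p y))
    have hopen : IsOpen (e.symm.trans e').source := (e.symm.trans e').open_source
    refine (contDiffGroupoid n I).mem_of_eqOnSource (closedUnderRestriction' hmem hopen) ⟨?_, ?_⟩
    · rw [OpenPartialHomeomorph.restr_source, hopen.interior_eq]
      exact (Set.inter_eq_right.2 fun z hz => (key z hz).2).symm
    · exact fun z hz => (key z hz).1
  exact { this with }

/-- In the pulled back charts `p` and its local inverses are the identity. -/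
theorem pullback_isLocalDiffeomorph (hp : IsLocalHomeomorph p) (n : WithTop ℕ∞)
    [IsManifold I n M] :
    letI := pullbackChartedSpace (H := H) hp
    IsLocalDiffeomorph I I n p := by
  let := pullbackChartedSpace (H := H) hp
  have := pullback_isManifold (I := I) hp n
  intro x
  have hl (x : M') : (chartAt H x : OpenPartialHomeomorph M' H)
      = (localHomeo hp x).trans (chartAt H (p x)) := rfl
  have hp_smooth : ContMDiff I I n p := by
    intro z
    have h1 : ContMDiffAt I I n (chartAt H z) z :=
      contMDiffOn_chart.contMDiffAt (chart_source_mem_nhds H z)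
    have hz : chartAt H z z = chartAt H (p z) (p z) := by
      rw [hl, OpenPartialHomeomorph.coe_trans, Function.comp_apply, coe_localHomeo]
    have h2 : ContMDiffAt I I n (chartAt H (p z)).symm (chartAt H z z) := by
      rw [hz]
      exact contMDiffOn_chart_symm.contMDiffAt (chart_target_mem_nhds H (p z))
    refine (h2.comp z h1).congr_of_eventuallyEq ?_
    filter_upwards [chart_source_mem_nhds H z] with w hw
    have hw' := hw
    rw [hl, OpenPartialHomeomorph.trans_source] at hw'
    rw [Function.comp_apply, hl, OpenPartialHomeomorph.coe_trans, Function.comp_apply]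
    have := hw'.2
    rw [Set.mem_preimage] at this
    rw [(chartAt H (p z)).left_inv this, coe_localHomeo]
  refine ⟨{ (localHomeo hp x).toPartialEquiv with
    open_source := (localHomeo hp x).open_source
    open_target := (localHomeo hp x).open_target
    contMDiffOn_toFun := ?_
    contMDiffOn_invFun := ?_ }, mem_localHomeo_source hp x, ?_⟩
  · change ContMDiffOn I I n (localHomeo hp x) _
    rw [coe_localHomeo]
    exact hp_smooth.contMDiffOn
  · change ContMDiffOn I I n (localHomeo hp x).symm (localHomeo hp x).target
    intro y hy
    refine ContMDiffAt.contMDiffWithinAt ?_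
    set z := (localHomeo hp x).symm y with hz
    have hpz : p z = y := localHomeo_symm hp x hy
    have hzz : chartAt H z z = chartAt H (p z) (p z) := by
      rw [hl, OpenPartialHomeomorph.coe_trans, Function.comp_apply, coe_localHomeo]
    have h1 : ContMDiffAt I I n (chartAt H (p z)) y := by
      rw [← hpz]
      exact contMDiffOn_chart.contMDiffAt (chart_source_mem_nhds H (p z))
    have h2 : ContMDiffAt I I n (chartAt H z).symm (chartAt H (p z) y) := by
      have : chartAt H (p z) y = chartAt H z z := by rw [hzz, hpz]
      rw [this]
      exact contMDiffOn_chart_symm.contMDiffAt (chart_target_mem_nhds H z)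
    refine (h2.comp y h1).congr_of_eventuallyEq ?_
    have c1 : (localHomeo hp x).target ∈ 𝓝 y := (localHomeo hp x).open_target.mem_nhds hy
    have c2 : (chartAt H (p z)).source ∈ 𝓝 y := hpz ▸ chart_source_mem_nhds H (p z)
    have c3 : ∀ᶠ w in 𝓝 y, (localHomeo hp x).symm w ∈ (localHomeo hp z).source :=
      ((localHomeo hp x).continuousAt_symm hy).preimage_mem_nhds
        ((localHomeo hp z).open_source.mem_nhds (mem_localHomeo_source hp z))
    filter_upwards [c1, c2, c3] with w h1 h2 h3
    rw [Function.comp_apply, hl, OpenPartialHomeomorph.trans_symm_eq_symm_trans_symm,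
      OpenPartialHomeomorph.coe_trans, Function.comp_apply, (chartAt H (p z)).left_inv h2]
    have h4 := (localHomeo hp z).left_inv h3
    rw [coe_localHomeo, localHomeo_symm hp x h1] at h4
    exact h4.symm
  · intro w _
    change p w = localHomeo hp x w
    rw [coe_localHomeo]

/-- Near each point `f` is a smooth local inverse of `p` composed with `p ∘ f`; continuity keeps `f`
where that inverse is valid. -/
theorem contMDiff_of_comp_localDiffeomorph {F' H' N : Type*} [NormedAddCommGroup F']
    [NormedSpace 𝕜 F'] [TopologicalSpace H'] {J : ModelWithCorners 𝕜 F' H'} [TopologicalSpace N]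
    [ChartedSpace H' N] [ChartedSpace H M'] {n : WithTop ℕ∞} (hp : IsLocalDiffeomorph I I n p)
    {f : N → M'} (hf : Continuous f) (hpf : ContMDiff J I n (p ∘ f)) : ContMDiff J I n f := by
  intro x
  have h1 := ((hp (f x)).localInverse_contMDiffAt).comp x (hpf x)
  refine h1.congr_of_eventuallyEq ?_
  have h2 := hf.continuousAt.eventually ((hp (f x)).localInverse_eventuallyEq_left)
  exact h2.mono fun y hy => hy.symm

/-- A topological monoid structure on a group, locally homeomorphic to a topological group by a
homomorphism, has continuous inversion. -/
theorem continuousInv_of_isLocalHomeomorph {G G' : Type*} [TopologicalSpace G] [Group G]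
    [ContinuousInv G] [TopologicalSpace G'] [Group G'] [ContinuousMul G'] (β : G' →* G)
    (hβ : IsLocalHomeomorph β) : ContinuousInv G' := by
  refine ⟨continuous_iff_continuousAt.2 fun x => ?_⟩
  set l := localHomeo hβ x⁻¹
  have hx : (β x)⁻¹ ∈ l.target := by
    have := l.map_source (mem_localHomeo_source hβ x⁻¹)
    rwa [coe_localHomeo, map_inv] at this
  have hlx : l.symm (β x)⁻¹ = x⁻¹ := by
    have := l.left_inv (mem_localHomeo_source hβ x⁻¹)
    rwa [coe_localHomeo, map_inv] at this
  have hinv : ContinuousAt (fun z => (β z)⁻¹) x := (hβ.continuous.inv).continuousAt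
  have hs : ContinuousAt (fun z => l.symm (β z)⁻¹) x :=
    ContinuousAt.comp (f := fun z => (β z)⁻¹) (l.continuousAt_symm hx) hinv
  have hw : ContinuousAt (fun z => z * l.symm (β z)⁻¹) x := continuousAt_id.mul hs
  have hw1 : x * l.symm (β x)⁻¹ = 1 := by rw [hlx, mul_inv_cancel]
  -- The continuous candidate `l.symm (β z)⁻¹` is the inverse of `z` near `x`: its product with `z`
  -- lies over `1` and is close to `1`, where `β` is injective.
  refine hs.congr ?_
  have e1 : ∀ᶠ z in 𝓝 x, z * l.symm (β z)⁻¹ ∈ (localHomeo hβ 1).source := by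
    refine hw.preimage_mem_nhds ((localHomeo hβ 1).open_source.mem_nhds ?_)
    rw [hw1]
    exact mem_localHomeo_source hβ 1
  have e2 : ∀ᶠ z in 𝓝 x, (β z)⁻¹ ∈ l.target := hinv.preimage_mem_nhds (l.open_target.mem_nhds hx)
  filter_upwards [e1, e2] with z h1 h2
  refine (inv_eq_of_mul_eq_one_right ?_).symm
  refine (localHomeo hβ 1).injOn h1 (mem_localHomeo_source hβ 1) ?_
  rw [coe_localHomeo, map_mul, localHomeo_symm hβ _ h2, mul_inv_cancel, map_one]

theorem pullback_lieGroup {G G' : Type*} [TopologicalSpace G] [Group G] [ChartedSpace H G]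
    {n : WithTop ℕ∞} [LieGroup I n G] [TopologicalSpace G'] [Group G'] [ContinuousMul G']
    (β : G' →* G) (hβ : IsLocalHomeomorph β) :
    letI := pullbackChartedSpace (H := H) hβ
    LieGroup I n G' := by
  let := pullbackChartedSpace (H := H) hβ
  have := pullback_isManifold (I := I) hβ n
  have : IsTopologicalGroup G := topologicalGroup_of_lieGroup I n
  have := continuousInv_of_isLocalHomeomorph β hβ
  have hd : IsLocalDiffeomorph I I n β := pullback_isLocalDiffeomorph hβ n
  have hmul : ContMDiff (I.prod I) I n fun z : G' × G' => z.1 * z.2 := by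
    refine contMDiff_of_comp_localDiffeomorph hd continuous_mul ?_
    have : (β ∘ fun z : G' × G' => z.1 * z.2) = fun z => β z.1 * β z.2 :=
      funext fun z => map_mul β _ _
    rw [this]
    exact (hd.contMDiff.comp contMDiff_fst).mul (hd.contMDiff.comp contMDiff_snd)
  have hinv : ContMDiff I I n fun z : G' => z⁻¹ := by
    refine contMDiff_of_comp_localDiffeomorph hd continuous_inv ?_
    have : (β ∘ fun z : G' => z⁻¹) = fun z => (β z)⁻¹ := funext fun z => map_inv β _
    rw [this]
    exact hd.contMDiff.inv
  exact { contMDiff_mul := hmul, contMDiff_inv := hinv }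

end Pullback

/-! ### Continuity of the adjoint representation -/

section AdContinuous

open Topology

variable (d : ℕ) {G : Type u} [TopologicalSpace G] [Group G]
  [ChartedSpace (EuclideanSpace ℝ (Fin d)) G] [LieGroup (𝓡 d) ∞ G]

theorem inTangentCoordinates_of_eq {𝕜 E E' H H' M M' N : Type*} [NontriviallyNormedField 𝕜]
    [NormedAddCommGroup E] [NormedSpace 𝕜 E] [NormedAddCommGroup E'] [NormedSpace 𝕜 E']
    [TopologicalSpace H] [TopologicalSpace H'] {I : ModelWithCorners 𝕜 E H}
    {I' : ModelWithCorners 𝕜 E' H'} [TopologicalSpace M] [ChartedSpace H M] [TopologicalSpace M']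
    [ChartedSpace H' M'] [IsManifold I 1 M] [IsManifold I' 1 M'] (f : N → M) (g : N → M')
    (ϕ : N → E →L[𝕜] E') {x₀ x : N} (hf : f x = f x₀) (hg : g x = g x₀) :
    inTangentCoordinates I I' f g ϕ x₀ x = ϕ x := by
  rw [inTangentCoordinates_eq f g ϕ (hf ▸ mem_chart_source H (f x)) (hg ▸ mem_chart_source H' (g x)),
    hf, hg]
  ext v
  rw [ContinuousLinearMap.comp_apply, ContinuousLinearMap.comp_apply,
    (tangentBundleCore I M).coordChange_self _ _ (mem_chart_source H (f x₀)),
    (tangentBundleCore I' M').coordChange_self _ _ (mem_chart_source H' (g x₀))]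

/-- `Ad g` is the partial differential at `1` of the jointly smooth map `(g, x) ↦ g x g⁻¹`. As every
conjugation fixes `1`, the tangent coordinates that express its continuous dependence on `g` are
trivial. -/
theorem continuous_Ad_apply (v : GroupLieAlgebra (𝓡 d) G) : Continuous fun g => Ad d g v := by
  have hman : IsManifold (𝓡 d) 1 G := IsManifold.of_le (n := ∞) (by simp)
  refine continuous_iff_continuousAt.2 fun g₀ => ?_
  have h1 : ContMDiff ((𝓡 d).prod (𝓡 d)) (𝓡 d) ∞
      (Function.uncurry fun g x : G => g * x * g⁻¹) :=
    (contMDiff_fst.mul contMDiff_snd).mul contMDiff_fst.inv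
  have h2 := (ContMDiffAt.mfderiv (m := 0) (x₀ := g₀) (fun g x : G => g * x * g⁻¹)
    (fun _ => (1 : G)) h1.contMDiffAt contMDiffAt_const (by simp)).continuousAt
  have h3 : (fun g => Ad d g v) = fun g => inTangentCoordinates (𝓡 d) (𝓡 d) (fun _ => (1 : G))
      (fun g : G => g * 1 * g⁻¹) (fun g => mfderiv (𝓡 d) (𝓡 d) (fun x => g * x * g⁻¹) 1) g₀ g v := by
    funext g
    exact (DFunLike.congr_fun (inTangentCoordinates_of_eq (I := 𝓡 d) (I' := 𝓡 d)
      (fun _ => (1 : G)) (fun g : G => g * 1 * g⁻¹)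
      (fun g => mfderiv (𝓡 d) (𝓡 d) (fun x => g * x * g⁻¹) 1) rfl (by simp)) v).symm
  rw [h3]
  exact h2.clm_apply continuousAt_const

end AdContinuous

/-! ### Representations preserving an indefinite form -/

section ConeRepresentation

theorem exists_isometry_of_pos_def {V : Type*} [AddCommGroup V] [Module ℝ V]
    [FiniteDimensional ℝ V] (B : LinearMap.BilinForm ℝ V) (hsymm : ∀ v w, B v w = B w v)
    (hpos : ∀ v, v ≠ 0 → 0 < B v v) :
    ∃ (n : ℕ) (Ψ : EuclideanSpace ℝ (Fin n) ≃ₗ[ℝ] V), ∀ v w, B (Ψ v) (Ψ w) = inner ℝ v w := by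
  let core : InnerProductSpace.Core ℝ V :=
    { inner := fun v w => B v w
      conj_inner_symm := fun v w => hsymm w v
      re_inner_nonneg := fun v => by
        rcases eq_or_ne v 0 with rfl | hv
        · simp
        · exact (hpos v hv).le
      add_left := fun u v w => by simp
      smul_left := fun u v r => by simp
      definite := fun v hv => by
        by_contra h
        exact (hpos v h).ne' hv }
  let : NormedAddCommGroup V := core.toNormedAddCommGroup
  let : InnerProductSpace ℝ V := InnerProductSpace.ofCore core.toCore
  let e := (stdOrthonormalBasis ℝ V).repr.symm
  exact ⟨_, e.toLinearEquiv, fun v w => e.inner_map_map v w⟩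

variable {n : ℕ} {W V G : Type*} [NormedAddCommGroup W] [NormedSpace ℝ W] [FiniteDimensional ℝ W]
  [AddCommGroup V] [Module ℝ V] [Group G] (Φ : (EuclideanSpace ℝ (Fin n) × W) ≃ₗ[ℝ] V)
  (r : Representation ℝ G V)

/-- A representation preserving the quadratic form `‖v‖ ^ 2 - ‖w‖ ^ 2`, in coordinates. -/
def coneRep (h : ∀ g u, ‖(Φ.symm (r g (Φ u))).1‖ ^ 2 - ‖(Φ.symm (r g (Φ u))).2‖ ^ 2
      = ‖u.1‖ ^ 2 - ‖u.2‖ ^ 2) : G →* coneMonoid n W where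
  toFun g := ⟨LinearMap.toContinuousLinearMap
      (Φ.symm.toLinearMap ∘ₗ r g ∘ₗ Φ.toLinearMap), fun u hu => by
    have h1 := h g u
    change ‖(Φ.symm (r g (Φ u))).2‖ < ‖(Φ.symm (r g (Φ u))).1‖
    refine lt_of_pow_lt_pow_left₀ 2 (norm_nonneg _) ?_
    have := pow_lt_pow_left₀ hu (norm_nonneg _) two_ne_zero
    linarith⟩
  map_one' := Subtype.ext <| ContinuousLinearMap.ext fun u => by
    change Φ.symm (r 1 (Φ u)) = u
    rw [map_one]
    exact Φ.symm_apply_apply u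
  map_mul' g k := Subtype.ext <| ContinuousLinearMap.ext fun u => by
    change Φ.symm (r (g * k) (Φ u)) = Φ.symm (r g (Φ (Φ.symm (r k (Φ u)))))
    rw [map_mul, Φ.apply_symm_apply]
    rfl

variable {Φ r}

theorem coneRep_apply (h) (g : G) (u) : (coneRep Φ r h g).1 u = Φ.symm (r g (Φ u)) := rfl

theorem continuous_coneRep [TopologicalSpace V] [IsTopologicalAddGroup V] [ContinuousSMul ℝ V]
    [T2Space V] [FiniteDimensional ℝ V] [TopologicalSpace G] (h)
    (hr : ∀ v, Continuous fun g => r g v) : Continuous (coneRep Φ r h) := by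
  refine Continuous.subtype_mk (continuous_clm_apply.2 fun u => ?_) _
  exact (LinearMap.continuous_of_finiteDimensional Φ.symm.toLinearMap).comp (hr (Φ u))

end ConeRepresentation

/-! ### The lift to the spin group -/

section Lift

variable {n : ℕ} {V : Type*} [AddCommGroup V] [Module ℂ V] {q : QuadraticForm ℂ V}
  {E : Module.Basis (Fin n) ℂ V} {W : Type*} [NormedAddCommGroup W] [NormedSpace ℝ W]
  {G : Type*} [Group G] [FiniteDimensional ℂ V] [NeZero n]
  (hE : IsOrthonormalFor q E) {ρ : G →* coneMonoid n W}

/-- Over `K` the pin component is multiplicative, and determinant one makes it fixed by the grading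
involution, hence even. The twisted relation then reads `x v = (τ v) x` for real vectors, and these
contain a complex basis. -/
theorem factorsOverSpin_of_block [TopologicalSpace G] (K : Subgroup G)
    (hblock : ∀ k ∈ K, IsBlockIsometry (ρ k))
    (hdet : ∀ k ∈ K, LinearMap.det (corner (ρ k).1 : EuclideanSpace ℝ (Fin n) →ₗ[ℝ] _) = 1)
    (τ : Representation ℂ K V)
    (hτ : ∀ (k : K) v, τ k (realVec E v) = realVec E (corner (ρ k).1 v)) :
    FactorsOverSpin q (τ.comp ((PinExt.proj hE ρ).subgroupComap K)) := by
  have hrot (x : K.comap (PinExt.proj hE ρ)) :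
      rot (ρ x.1.base) = corner (ρ x.1.base).1 := (hblock _ x.2).rot_eq
  have hinv (x : K.comap (PinExt.proj hE ρ)) :
      CliffordAlgebra.involute x.1.pin = x.1.pin := by
    have := x.1.mem.2.2.2
    rw [hrot] at this
    refine this.trans ?_
    have h1 : LinearMap.det (corner (ρ x.1.base).1 : EuclideanSpace ℝ (Fin n) →ₗ[ℝ] _) = 1 :=
      hdet _ x.2
    change ((LinearMap.det (corner (ρ x.1.base).1 : EuclideanSpace ℝ (Fin n) →ₗ[ℝ] _) : ℝ) : ℂ)
      • x.1.pin = x.1.pin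
    rw [h1, Complex.ofReal_one, one_smul]
  have hspin (x : K.comap (PinExt.proj hE ρ)) : x.1.pin ∈ spinGroup (-q) :=
    spinGroup.mem_iff.2 ⟨x.1.mem.2.1, mem_even_of_involute_eq (hinv x)⟩
  let φ : K.comap (PinExt.proj hE ρ) →* Spin q :=
    { toFun := fun x => ⟨x.1.pin, hspin x⟩
      map_one' := Subtype.ext (PinExt.pin_one (hE := hE) (ρ := ρ))
      map_mul' := fun x y => Subtype.ext <| PinExt.pin_mul_of_block (x := x.1) (y := y.1) (hblock _ x.2) (hblock _ y.2) }
  refine ⟨φ, ((PinExt.continuous_pin (hE := hE) (ρ := ρ)).comp continuous_subtype_val).subtype_mk _, ?_⟩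
  refine MonoidHom.ext fun x => E.ext fun i => ι_injective q ?_
  change CliffordAlgebra.ι (-q) (spinActVec q (φ x) (E i)) = CliffordAlgebra.ι (-q) (τ _ (E i))
  rw [ι_spinActVec, ← realVec_single E i, hτ]
  have h1 := x.1.mem.2.2.1 (EuclideanSpace.single i 1)
  rw [hinv, hrot] at h1
  have h2 : (φ x).1 * ((φ x)⁻¹).1 = 1 := congrArg Subtype.val (mul_inv_cancel (φ x))
  change (φ x).1 * γ q E (EuclideanSpace.single i 1) * ((φ x)⁻¹).1 = _
  have h3 : (φ x).1 * γ q E (EuclideanSpace.single i 1)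
    = γ q E (corner (ρ x.1.base).1 (EuclideanSpace.single i 1)) * (φ x).1 := h1
  rw [h3, mul_assoc, h2, mul_one]
  rfl

end Lift

/-! ### The Cartan decomposition -/

section Cartan

variable {d : ℕ} {G : Type u} [TopologicalSpace G] [Group G]
  [ChartedSpace (EuclideanSpace ℝ (Fin d)) G] {K : Subgroup G} {θ : G ≃* G}

theorem mem_p₀_iff {X : GroupLieAlgebra (𝓡 d) G} : X ∈ p₀ d θ ↔ diffOne d θ X = -X := by
  rw [p₀, Module.End.mem_eigenspace_iff, neg_one_smul]

theorem mem_k₀_iff {X : GroupLieAlgebra (𝓡 d) G} : X ∈ k₀ d θ ↔ diffOne d θ X = X := by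
  rw [k₀, Module.End.mem_eigenspace_iff, one_smul]

theorem diffOne_involutive (h : IsCartanInvolution d K θ) (X : GroupLieAlgebra (𝓡 d) G) :
    diffOne d θ (diffOne d θ X) = X := by
  have h1 := diffOne_comp d h.smooth h.smooth (map_one θ)
  have h2 : (fun x => θ (θ x)) = fun x : G => x := funext h.involutive
  rw [h2, diffOne_id] at h1
  exact (LinearMap.congr_fun h1 X).symm

variable (d θ) in
/-- An orthonormal real basis of `𝔭₀`, as a basis of `𝔭`. -/
def complexBasis {n : ℕ} (Ψ : EuclideanSpace ℝ (Fin n) ≃ₗ[ℝ] p₀ d θ) :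
    Module.Basis (Fin n) ℂ (P d θ) :=
  ((EuclideanSpace.basisFun (Fin n) ℝ).toBasis.map Ψ).baseChange ℂ

theorem complexBasis_apply {n : ℕ} (Ψ : EuclideanSpace ℝ (Fin n) ≃ₗ[ℝ] p₀ d θ) (i : Fin n) :
    complexBasis d θ Ψ i = 1 ⊗ₜ Ψ (EuclideanSpace.single i 1) := by
  simp [complexBasis]

theorem isCompl_p₀_k₀ (h : IsCartanInvolution d K θ) : IsCompl (p₀ d θ) (k₀ d θ) := by
  refine ⟨?_, codisjoint_iff_le_sup.2 fun X _ => ?_⟩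
  · exact (diffOne d θ).eigenspaces_iSupIndep.pairwiseDisjoint (by norm_num : (-1 : ℝ) ≠ 1)
  · refine Submodule.mem_sup.2 ⟨(1 / 2 : ℝ) • (X - diffOne d θ X), ?_,
      (1 / 2 : ℝ) • (X + diffOne d θ X), ?_, ?_⟩
    · rw [mem_p₀_iff, map_smul, map_sub, diffOne_involutive h, ← smul_neg, neg_sub]
    · rw [mem_k₀_iff, map_smul, map_add, diffOne_involutive h, add_comm]
    · module

theorem realVec_complexBasis {n : ℕ} (Ψ : EuclideanSpace ℝ (Fin n) ≃ₗ[ℝ] p₀ d θ)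
    (v : EuclideanSpace ℝ (Fin n)) : realVec (complexBasis d θ Ψ) v = 1 ⊗ₜ Ψ v := by
  have hv : v = ∑ i, v i • EuclideanSpace.single i (1 : ℝ) := by
    ext j
    simp [Finset.sum_apply, Pi.single_apply]
  conv_rhs => rw [hv, map_sum, TensorProduct.tmul_sum]
  refine Finset.sum_congr rfl fun i _ => ?_
  rw [complexBasis_apply, map_smul, TensorProduct.tmul_smul]
  rfl

variable [LieGroup (𝓡 d) ∞ G]

/-- Let `Y` be the `𝔭₀`-component of `Ad k X`. Invariance of `B` moves `Y` back to `Ad k⁻¹ Y ∈ 𝔭₀`,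
which is orthogonal to `X`; so `B Y Y = 0`, and positivity gives `Y = 0`. -/
theorem Ad_mem_k₀ (h : IsCartanInvolution d K θ) {B : LinearMap.BilinForm ℝ (GroupLieAlgebra (𝓡 d) G)}
    (hB : IsInvariantForm d θ B) (k : K) {X : GroupLieAlgebra (𝓡 d) G}
    (hX : X ∈ k₀ d θ) : Ad d k.1 X ∈ k₀ d θ := by
  have hsum := (isCompl_p₀_k₀ h).codisjoint.eq_top ▸ Submodule.mem_top (x := Ad d k.1 X)
  obtain ⟨Y, hY, Z, hZ, hYZ⟩ := Submodule.mem_sup.1 hsum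
  have hY' : Ad d (k⁻¹ : K).1 Y ∈ p₀ d θ := Ad_mem_p₀ h k⁻¹ hY
  have h1 : B (Ad d k.1 X) Y = 0 := by
    have := (hB.orthogonal _).1 hY' X hX
    rw [← hB.invariant k.1] at this
    have e : Ad d k.1 (Ad d (k⁻¹ : K).1 Y) = Y := by
      rw [← Module.End.mul_apply, ← map_mul]
      simp
    rwa [e] at this
  have h2 : B Z Y = 0 := (hB.orthogonal _).1 hY Z hZ
  have h3 : B Y Y = 0 := by
    rw [← hYZ, map_add, LinearMap.add_apply, h2, add_zero] at h1
    exact h1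
  have h4 : Y = 0 := by
    by_contra hne
    exact (hB.pos_def Y hY hne).ne' h3
  rw [← hYZ, h4, zero_add]
  exact hZ

theorem isOrthonormalFor_complexBasis {B : LinearMap.BilinForm ℝ (GroupLieAlgebra (𝓡 d) G)}
    (hB : IsInvariantForm d θ B) {n : ℕ} {Ψ : EuclideanSpace ℝ (Fin n) ≃ₗ[ℝ] p₀ d θ}
    (hΨ : ∀ v w, B (Ψ v) (Ψ w) = inner ℝ v w) :
    IsOrthonormalFor (q θ B) (complexBasis d θ Ψ) := by
  intro x
  have h1 : QuadraticMap.associated (q θ B)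
      = LinearMap.BilinForm.baseChange ℂ (B.restrict (p₀ d θ)) := by
    rw [q, QuadraticForm.associated_baseChange, QuadraticMap.associated_left_inverse ℝ]
    exact fun X Y => hB.symm X Y
  rw [← QuadraticMap.associated_eq_self_apply ℂ (q θ B), h1]
  simp only [map_sum, map_smul, LinearMap.sum_apply, LinearMap.smul_apply, complexBasis_apply,
    LinearMap.BilinForm.baseChange_tmul]
  have h2 (i j : Fin n) : (B.restrict (p₀ d θ)) (Ψ (EuclideanSpace.single i 1))
      (Ψ (EuclideanSpace.single j 1)) = if i = j then 1 else 0 := by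
    refine (hΨ _ _).trans ?_
    simp [EuclideanSpace.inner_single_left]
  simp only [h2]
  simp [sq]

end Cartan

end DoubleCover

end

/-! ### The double covering of the reductive group -/

open DoubleCover in
theorem lemma4p3 {d : ℕ} {G : Type u} [TopologicalSpace G] [Group G]
    [ChartedSpace (EuclideanSpace ℝ (Fin d)) G] [LieGroup (𝓡 d) ∞ G]
    (K : Subgroup G) (θ : G ≃* G) (hθ : IsCartanInvolution d K θ)
    (B : LinearMap.BilinForm ℝ (GroupLieAlgebra (𝓡 d) G)) (hB : IsInvariantForm d θ B)
    (hSO : ∀ k : K, AdP hθ k ∈ SO (q θ B))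
    (hlift : ¬ FactorsOverSpin (q θ B) (AdP hθ)) :
    ∃ (G' : Type u) (_ : TopologicalSpace G') (_ : Group G')
      (_ : ChartedSpace (EuclideanSpace ℝ (Fin d)) G') (_ : LieGroup (𝓡 d) ∞ G')
      (β : G' →* G),
      IsDoubleCovering d β ∧
      β.ker ≤ Subgroup.center G' ∧
      FactorsOverSpin (q θ B) ((AdP hθ).comp (β.subgroupComap K)) := by
  have hfin : FiniteDimensional ℝ (GroupLieAlgebra (𝓡 d) G) :=
    inferInstanceAs (FiniteDimensional ℝ (EuclideanSpace ℝ (Fin d)))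
  have hT2 : T2Space (GroupLieAlgebra (𝓡 d) G) :=
    inferInstanceAs (T2Space (EuclideanSpace ℝ (Fin d)))
  obtain ⟨n, Ψ, hΨ⟩ := exists_isometry_of_pos_def (B.restrict (p₀ d θ)) (fun X Y => hB.symm X Y)
    fun X hX => hB.pos_def X X.2 fun h => hX (Subtype.ext h)
  obtain ⟨m, Ψ', hΨ'⟩ := exists_isometry_of_pos_def (-B.restrict (k₀ d θ))
    (fun X Y => congrArg Neg.neg (hB.symm X Y))
    fun X hX => neg_pos.2 (hB.neg_def X X.2 fun h => hX (Subtype.ext h))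
  have hE : IsOrthonormalFor (q θ B) (complexBasis d θ Ψ) := isOrthonormalFor_complexBasis hB hΨ
  -- If `𝔭 = 0`, the trivial homomorphism to the spin group already factors `Ad`, against `hlift`.
  have hn : NeZero n := by
    refine ⟨?_⟩
    rintro rfl
    have : Subsingleton (P d θ) := (complexBasis d θ Ψ).repr.toEquiv.subsingleton
    exact hlift ⟨1, continuous_const, MonoidHom.ext fun k => LinearMap.ext fun v =>
      Subsingleton.elim _ _⟩
  let Φ : (EuclideanSpace ℝ (Fin n) × EuclideanSpace ℝ (Fin m)) ≃ₗ[ℝ] GroupLieAlgebra (𝓡 d) G :=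
    (Ψ.prodCongr Ψ').trans (Submodule.prodEquivOfIsCompl _ _ (isCompl_p₀_k₀ hθ))
  have hΦ (u) : Φ u = (Ψ u.1 : GroupLieAlgebra (𝓡 d) G) + Ψ' u.2 := rfl
  have hΦB (u) : B (Φ u) (Φ u) = ‖u.1‖ ^ 2 - ‖u.2‖ ^ 2 := by
    have h1 : B (Ψ u.1) (Ψ u.1) = ‖u.1‖ ^ 2 := (hΨ _ _).trans (real_inner_self_eq_norm_sq _)
    have h2 : -B (Ψ' u.2) (Ψ' u.2) = ‖u.2‖ ^ 2 := (hΨ' _ _).trans (real_inner_self_eq_norm_sq _)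
    have h3 : B (Ψ' u.2) (Ψ u.1) = 0 := (hB.orthogonal _).1 (Ψ u.1).2 _ (Ψ' u.2).2
    have h4 : B (Ψ u.1) (Ψ' u.2) = 0 := (hB.symm _ _).trans h3
    rw [hΦ, map_add, map_add, LinearMap.add_apply, LinearMap.add_apply, h3, h4]
    linarith
  have hform (g : G) (u) : ‖(Φ.symm (Ad d g (Φ u))).1‖ ^ 2 - ‖(Φ.symm (Ad d g (Φ u))).2‖ ^ 2
      = ‖u.1‖ ^ 2 - ‖u.2‖ ^ 2 := by
    rw [← hΦB, ← hΦB, Φ.apply_symm_apply, hB.invariant]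
  let ρ := coneRep Φ (Ad d) hform
  have hρ : Continuous ρ := continuous_coneRep hform (continuous_Ad_apply d)
  have hp (k : K) (v) : (ρ k).1 (v, 0) = (Ψ.symm (AdReal hθ k (Ψ v)), 0) := by
    rw [coneRep_apply, LinearEquiv.symm_apply_eq, hΦ, hΦ, map_zero, LinearEquiv.apply_symm_apply]
    simp
    rfl
  have hk (k : K) (w) : ((ρ k).1 (0, w)).1 = 0 := by
    have : (ρ k).1 (0, w) = (0, Ψ'.symm ⟨Ad d k.1 (Ψ' w), Ad_mem_k₀ hθ hB k (Ψ' w).2⟩) := by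
      rw [coneRep_apply, LinearEquiv.symm_apply_eq, hΦ, hΦ, map_zero, LinearEquiv.apply_symm_apply]
      simp
    rw [this]
  have hcorner (k : K) (v) : corner (ρ k).1 v = Ψ.symm (AdReal hθ k (Ψ v)) := by
    rw [corner_apply, hp]
  have hblock (k) (hkK : k ∈ K) : IsBlockIsometry (ρ k) := by
    refine ⟨fun v => ?_, fun v => congrArg Prod.snd (hp ⟨k, hkK⟩ v), hk ⟨k, hkK⟩⟩
    have h1 := hform k (v, 0)
    change ‖((ρ k).1 (v, 0)).1‖ ^ 2 - ‖((ρ k).1 (v, 0)).2‖ ^ 2 = _ at h1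
    rw [hp ⟨k, hkK⟩] at h1
    rw [hcorner ⟨k, hkK⟩]
    simpa using h1
  have hdet (k) (hkK : k ∈ K) :
      LinearMap.det (corner (ρ k).1 : EuclideanSpace ℝ (Fin n) →ₗ[ℝ] _) = 1 := by
    have h1 : (corner (ρ k).1 : EuclideanSpace ℝ (Fin n) →ₗ[ℝ] _)
        = Ψ.symm.toLinearMap ∘ₗ AdReal hθ ⟨k, hkK⟩ ∘ₗ Ψ.toLinearMap :=
      LinearMap.ext fun v => hcorner ⟨k, hkK⟩ v
    -- The determinant condition is given on the complexification; it is the image in `ℂ` of the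
    -- real determinant on `𝔭₀`.
    have h2 : LinearMap.det ((AdReal hθ ⟨k, hkK⟩).baseChange ℂ) = 1 := (hSO ⟨k, hkK⟩).2
    rw [LinearMap.det_baseChange] at h2
    rw [h1]
    have h3 := LinearMap.det_conj (AdReal hθ ⟨k, hkK⟩) Ψ.symm
    rw [LinearEquiv.symm_symm] at h3
    refine h3.trans ?_
    exact Complex.ofReal_injective h2
  have hG : IsTopologicalGroup G := topologicalGroup_of_lieGroup (𝓡 d) ∞
  have hmul : ContinuousMul (PinExt hE ρ) := PinExt.continuousMul hρ
  have hcov : IsCoveringMap (PinExt.proj hE ρ) := PinExt.isCoveringMap_proj hρ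
  refine ⟨PinExt hE ρ, inferInstance, inferInstance,
    pullbackChartedSpace hcov.isLocalHomeomorph, pullback_lieGroup _ hcov.isLocalHomeomorph,
    PinExt.proj hE ρ, ?_, PinExt.ker_proj_le_center, ?_⟩
  · exact @IsDoubleCovering.mk _ _ _ _ _ _ _ _ (_) _ hcov
      (pullback_isLocalDiffeomorph hcov.isLocalHomeomorph ∞)
      PinExt.surjective_base PinExt.card_ker_proj
  · refine factorsOverSpin_of_block hE K hblock hdet (AdP hθ) fun k v => ?_
    rw [realVec_complexBasis, realVec_complexBasis, hcorner, LinearEquiv.apply_symm_apply]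
    rfl
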